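/- All graphs are finite and simple. To double subdivide an edge $uv$ of a graph means to delete the edge $uv$, add two new vertices, and join both of them to $u$ and to $v$. A generalised triangle is $K_3$ or any graph obtained from $K_3$ by a finite sequence of double subdivisions of edges. A $2$-cut of a graph $G$ is a set $\{x,y\}$ of two vertices whose removal increases the number of connected components. For a $2$-cut $\{x,y\}$ of $G$, an $\{x,y\}$-bridge is a subgraph $G[V(C)\cup\{x,y\}]$, where $C$ is a connected component of $G-\{x,y\}$. Let $\mathcal{K}_1$ be the class of generalised triangles $G$ such that for every $2$-cut $\{x,y\}$ of $G$ and every $\{x,y\}$-bridge $B$, at least one of $x$ and $y$ has degree $1$ in $B$. Let $H_0$ be the graph formed from $K_3$ by double subdividing each of its three edges. If $G$ is a generalised triangle, then $G \in \mathcal{K}_1$ if and only if $H_0$ is not a minor of $G$. -/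

import Mathlib

namespace SimpleGraph

universe u v

/-- `G.doubleSubdivision a b`, for an edge `ab` of `G`: delete the edge `ab`, add two new
vertices, and join both of them to `a` and to `b`. -/
def doubleSubdivision {V : Type u} (G : SimpleGraph V) (a b : V) : SimpleGraph (V ⊕ Fin 2) where
  Adj
    | .inl p, .inl q => (G.deleteEdges {s(a, b)}).Adj p q
    | .inl p, .inr _ => p = a ∨ p = b
    | .inr _, .inl q => q = a ∨ q = b
    | .inr _, .inr _ => False
  symm := ⟨by
    rintro (p | p) (q | q) h
    · exact h.symm
    · exact h
    · exact h
    · exact h⟩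
  loopless := ⟨by
    rintro (p | p) h
    · exact h.ne rfl
    · exact h⟩

/-- A graph is a generalised triangle if it is (isomorphic to) `K₃` or is obtained from `K₃`
by a sequence of double subdivisions of edges. -/
inductive IsGeneralisedTriangle : {V : Type u} → SimpleGraph V → Prop
  | triangle {V : Type u} {G : SimpleGraph V}
      (e : G ≃g (⊤ : SimpleGraph (Fin 3))) : IsGeneralisedTriangle G
  | doubleSubdivision {V W : Type u} {G : SimpleGraph V} {H : SimpleGraph W} {a b : V}
      (hG : IsGeneralisedTriangle G) (hab : G.Adj a b)
      (e : H ≃g G.doubleSubdivision a b) : IsGeneralisedTriangle H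

/-- A set of vertices whose removal increases the number of components
(for graphs with finitely many vertices). -/
def IsCutSet {V : Type u} (G : SimpleGraph V) (S : Set V) : Prop :=
  Nat.card G.ConnectedComponent < Nat.card (G.induce Sᶜ).ConnectedComponent

/-- `{x, y}` is a 2-cut of `G`: a cut-set with exactly two elements. -/
def IsTwoCut {V : Type u} (G : SimpleGraph V) (x y : V) : Prop :=
  x ≠ y ∧ G.IsCutSet {x, y}

/-- The `{x, y}`-bridge of `G` belonging to a component `C` of `G - {x, y}`:
the subgraph of `G` induced by `V(C) ∪ {x, y}`. -/
def twoCutBridge {V : Type u} (G : SimpleGraph V) (x y : V)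
    (C : (G.induce ({x, y} : Set V)ᶜ).ConnectedComponent) : G.Subgraph :=
  (⊤ : G.Subgraph).induce (Subtype.val '' C.supp ∪ {x, y})

/-- Property `P₁` of a 2-cut `{x, y}`: in every `{x, y}`-bridge,
at least one of `x` and `y` has degree 1. -/
def PropertyP1 {V : Type u} (G : SimpleGraph V) (x y : V) : Prop :=
  ∀ C : (G.induce ({x, y} : Set V)ᶜ).ConnectedComponent,
    ((G.twoCutBridge x y C).neighborSet x).ncard = 1 ∨
      ((G.twoCutBridge x y C).neighborSet y).ncard = 1

/-- The class `K₁`: the generalised triangles all of whose 2-cuts have property `P₁`. -/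
def MemK1 {V : Type u} (G : SimpleGraph V) : Prop :=
  G.IsGeneralisedTriangle ∧ ∀ x y : V, G.IsTwoCut x y → G.PropertyP1 x y

/-- `H` is a minor of `G`: there are pairwise disjoint (nonempty) connected branch sets in `G`,
one for each vertex of `H`, with an edge of `G` between the branch sets of any two adjacent
vertices of `H`. -/
def IsMinor {W : Type v} {V : Type u} (H : SimpleGraph W) (G : SimpleGraph V) : Prop :=
  ∃ B : W → Set V,
    (∀ w, (G.induce (B w)).Connected) ∧
    (∀ w w', w ≠ w' → Disjoint (B w) (B w')) ∧
    ∀ w w', H.Adj w w' → ∃ p ∈ B w, ∃ q ∈ B w', G.Adj p q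

/-- `H₀`: the graph formed from `K₃`, with vertices `0, 1, 2`, by applying the double
subdivision operation to each of its edges `01`, `12` and `02`. -/
def H0 : SimpleGraph (((Fin 3 ⊕ Fin 2) ⊕ Fin 2) ⊕ Fin 2) :=
  (((⊤ : SimpleGraph (Fin 3)).doubleSubdivision 0 1).doubleSubdivision
    (.inl 1) (.inl 2)).doubleSubdivision (.inl (.inl 0)) (.inl (.inl 2))

end SimpleGraph

/-! Call a 2-cut thick if both of its vertices have two neighbours in the same component of the
rest. In a generalised triangle, deleting a vertex or the two ends of an edge leaves a connected
graph (`EdgeRobust`). Hence the vertices of a 2-cut are nonadjacent and each has a neighbour in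
every component, so K₁ is characterised by the absence of thick cuts
(`EdgeRobust.forall_propertyP1_iff`). It remains to see that thick cuts and H₀-minors occur
together, by induction on double subdivisions; both persist under them.

Let the edge ab be double subdivided. If a and b both have degree at least three, both obstructions
occur: {a, b} becomes a thick cut, separating the new vertices from the connected rest, and ab is
the simple edge of a model of K₃ with two doubled edges (`ThickEdgesRooted`), which grows into a
model of H₀.

If a has only the neighbours b and c, neither obstruction is created. By `DegreeTwoSplit`, b and c
are nonadjacent and their removal leaves a and two connected parts, each attached to both b and c.
Some part avoids any given vertex, which lets thick cuts descend
(`HasThickCut.of_doubleSubdivision`). In a model of H₀, a new vertex forming a branch set on its own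
is replaced by a, and a second one by a free part of the split (`H0_isMinor_of_doubleSubdivision`).

K₃ violates `DegreeTwoSplit`, so the induction for the invariant starts at K₂,₃. -/

namespace SimpleGraph

universe u

variable {V : Type*} {V' : Type*} {W : Type*} {W' : Type*}

/-! ### Connected vertex sets -/

/-- The vertex set `S` is nonempty and spans a connected subgraph: it has no proper nonempty subset
that is closed under adjacency. -/
def IsConn (G : SimpleGraph V) (S : Set V) : Prop :=
  S.Nonempty ∧ ∀ T ⊆ S, T.Nonempty → (∀ u ∈ T, ∀ v ∈ S, G.Adj u v → v ∈ T) → S ⊆ T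

/-- The formulation by closed subsets replaces walks: a property holds throughout a connected set
once it holds somewhere and passes along edges. -/
theorem connected_induce_iff_isConn {G : SimpleGraph V} {S : Set V} :
    (G.induce S).Connected ↔ G.IsConn S := by
  constructor
  · intro h
    obtain ⟨x⟩ := h.nonempty
    refine ⟨⟨x.1, x.2⟩, fun T hTS ⟨t, ht⟩ hT s hs => ?_⟩
    obtain ⟨p⟩ := h.preconnected ⟨t, hTS ht⟩ ⟨s, hs⟩
    have key : ∀ (u v : S) (_ : (G.induce S).Walk u v), u.1 ∈ T → v.1 ∈ T := by
      intro u v p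
      induction p with
      | nil => exact id
      | cons e _ ih => exact fun hu => ih (hT _ hu _ (Subtype.property _) e)
    exact key _ _ p ht
  · rintro ⟨⟨x, hx⟩, h⟩
    have : Nonempty S := ⟨⟨x, hx⟩⟩
    refine ⟨fun u v => ?_⟩
    have := h {w | ∃ hw : w ∈ S, (G.induce S).Reachable u ⟨w, hw⟩} (fun w hw => hw.1)
      ⟨u.1, u.2, .refl _⟩ ?_ v.2
    · exact this.2
    · rintro w ⟨hw, hr⟩ z hz hwz
      exact ⟨hz, hr.trans (Adj.reachable (by exact hwz))⟩

theorem isConn_singleton (G : SimpleGraph V) (v : V) : G.IsConn {v} := by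
  refine ⟨⟨v, rfl⟩, fun T hT ⟨t, ht⟩ _ s hs => ?_⟩
  obtain rfl : t = v := hT ht
  obtain rfl : s = t := hs
  exact ht

theorem IsConn.exists_adj_of_mem {G : SimpleGraph V} {S : Set V} (h : G.IsConn S) {u v : V}
    (hu : u ∈ S) (hv : v ∈ S) (huv : v ≠ u) : ∃ w ∈ S, G.Adj u w := by
  by_contra! hc
  exact huv (h.2 {u} (by simpa) ⟨u, rfl⟩ (by
    rintro _ rfl w hw e
    exact (hc w hw e).elim) hv)

/-- A connected set stays connected when a part attached to the rest at a single vertex is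
removed. -/
theorem IsConn.diff {G : SimpleGraph V} {S R : Set V} (h : G.IsConn S) {z : V} (hz : z ∈ S)
    (hzR : z ∉ R) (hR : ∀ u ∈ S, u ∉ R → u ≠ z → ∀ r ∈ S, r ∈ R → ¬ G.Adj u r) :
    G.IsConn (S \ R) := by
  -- A closed set missing `z` would already be closed in `S`. Both `T` and its complement are
  -- closed, so both would contain `z`.
  have key : ∀ T ⊆ S \ R, T.Nonempty → (∀ u ∈ T, ∀ v ∈ S \ R, G.Adj u v → v ∈ T) → z ∈ T := by
    intro T hTS hne hT
    by_contra hzT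
    refine hzT (h.2 T (fun t ht => (hTS ht).1) hne (fun u hu v hv e => ?_) hz)
    by_cases hvR : v ∈ R
    · exact (hR u (hTS hu).1 (hTS hu).2 (fun h => hzT (h ▸ hu)) v hv hvR e).elim
    · exact hT u hu v ⟨hv, hvR⟩ e
  refine ⟨⟨z, hz, hzR⟩, fun T hTS hne hT s hs => ?_⟩
  by_contra hsT
  have := key ((S \ R) \ T) Set.sdiff_subset ⟨s, hs, hsT⟩
    (fun u hu v hv e => ⟨hv, fun hvT => hu.2 (hT v hvT u hu.1 e.symm)⟩)
  exact this.2 (key T hTS hne hT)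

theorem IsConn.map_iso {G : SimpleGraph V} {G' : SimpleGraph V'} (e : G ≃g G') {S : Set V'}
    (h : G.IsConn (e ⁻¹' S)) : G'.IsConn S := by
  obtain ⟨⟨x, hx⟩, h⟩ := h
  refine ⟨⟨e x, hx⟩, fun T hTS ⟨t, ht⟩ hT s hs => ?_⟩
  have := h (e ⁻¹' T) (fun a ha => hTS ha) ⟨e.symm t, by simpa using ht⟩
    (fun u hu v hv huv => hT _ hu _ hv (e.map_adj_iff.2 huv))
    (show e.symm s ∈ _ by simpa using hs)
  simpa using this

/-! ### Minor models -/

/-- `B` is a family of branch sets in `G` of a minor `H`. -/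
structure IsModel (H : SimpleGraph W) (G : SimpleGraph V) (B : W → Set V) : Prop where
  conn : ∀ w, G.IsConn (B w)
  eq_of_mem : ∀ w w' x, x ∈ B w → x ∈ B w' → w = w'
  adj : ∀ w w', H.Adj w w' → ∃ p ∈ B w, ∃ q ∈ B w', G.Adj p q

theorem isMinor_iff_exists_isModel {H : SimpleGraph W} {G : SimpleGraph V} :
    H.IsMinor G ↔ ∃ B, H.IsModel G B := by
  refine exists_congr fun B => ⟨fun ⟨h1, h2, h3⟩ => ?_, fun ⟨h1, h2, h3⟩ => ?_⟩
  · refine ⟨fun w => connected_induce_iff_isConn.1 (h1 w), fun w w' x hx hx' => ?_, h3⟩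
    by_contra hne
    exact Set.disjoint_left.1 (h2 w w' hne) hx hx'
  · refine ⟨fun w => connected_induce_iff_isConn.2 (h1 w), fun w w' hne => ?_, h3⟩
    exact Set.disjoint_left.2 fun x hx hx' => hne (h2 w w' x hx hx')

theorem IsModel.comp {H : SimpleGraph W} {H' : SimpleGraph W'} {G : SimpleGraph V} {B : W → Set V}
    (h : H.IsModel G B) (f : W' → W) (hf : f.Injective)
    (hadj : ∀ x y, H'.Adj x y → H.Adj (f x) (f y)) : H'.IsModel G (B ∘ f) :=
  ⟨fun _ => h.conn _, fun _ _ x hx hx' => hf (h.eq_of_mem _ _ x hx hx'),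
    fun _ _ e => h.adj _ _ (hadj _ _ e)⟩

theorem IsModel.map_iso {H : SimpleGraph W} {G : SimpleGraph V} {G' : SimpleGraph V'}
    {B : W → Set V} (h : H.IsModel G B) (e : G ≃g G') :
    H.IsModel G' (fun w => e.symm ⁻¹' B w) := by
  refine ⟨fun w => IsConn.map_iso e ?_, fun w w' x hx hx' => h.eq_of_mem _ _ _ hx hx',
    fun w w' hw => ?_⟩
  · convert h.conn w using 1
    ext; simp
  · obtain ⟨p, hp, q, hq, hpq⟩ := h.adj w w' hw
    exact ⟨e p, by simpa using hp, e q, by simpa using hq, e.map_adj_iff.2 hpq⟩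

theorem IsModel.card_le [Fintype W] [Fintype V] {H : SimpleGraph W} {G : SimpleGraph V}
    {B : W → Set V} (h : H.IsModel G B) : Fintype.card W ≤ Fintype.card V := by
  choose f hf using fun w => (h.conn w).1
  exact Fintype.card_le_of_injective f fun w w' e => h.eq_of_mem w w' _ (hf w) (e ▸ hf w')

/-! ### Connectivity and minor models under double subdivision -/

section DoubleSubdivision

variable {G : SimpleGraph V} {a b : V}

@[simp] theorem doubleSubdivision_adj_inl_inl {p q : V} :
    (G.doubleSubdivision a b).Adj (.inl p) (.inl q) ↔ G.Adj p q ∧ s(p, q) ≠ s(a, b) := by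
  simp [doubleSubdivision]

@[simp] theorem doubleSubdivision_adj_inl_inr {p : V} {i : Fin 2} :
    (G.doubleSubdivision a b).Adj (.inl p) (.inr i) ↔ p = a ∨ p = b := Iff.rfl

@[simp] theorem doubleSubdivision_adj_inr_inl {p : V} {i : Fin 2} :
    (G.doubleSubdivision a b).Adj (.inr i) (.inl p) ↔ p = a ∨ p = b := Iff.rfl

@[simp] theorem doubleSubdivision_adj_inr_inr {i j : Fin 2} :
    (G.doubleSubdivision a b).Adj (.inr i) (.inr j) ↔ False := Iff.rfl

instance [DecidableEq V] [DecidableRel G.Adj] : DecidableRel (G.doubleSubdivision a b).Adj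
  | .inl _, .inl _ => decidable_of_iff' _ doubleSubdivision_adj_inl_inl
  | .inl _, .inr _ => decidable_of_iff' _ doubleSubdivision_adj_inl_inr
  | .inr _, .inl _ => decidable_of_iff' _ doubleSubdivision_adj_inr_inl
  | .inr _, .inr _ => decidable_of_iff' _ doubleSubdivision_adj_inr_inr

theorem doubleSubdivision_comm (G : SimpleGraph V) (a b : V) :
    G.doubleSubdivision a b = G.doubleSubdivision b a := by
  ext (p | p) (q | q) <;> simp [or_comm, Sym2.eq_swap]

/-- Isomorphic graphs have isomorphic double subdivisions. -/
def doubleSubdivisionCongr {G' : SimpleGraph V'} (e : G ≃g G') (a b : V) :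
    G.doubleSubdivision a b ≃g G'.doubleSubdivision (e a) (e b) where
  toEquiv := e.toEquiv.sumCongr (.refl _)
  map_rel_iff' := by
    rintro (p | p) (q | q)
    · have : (s(e p, e q) = s(e a, e b)) ↔ s(p, q) = s(a, b) := by simp
      simp only [Equiv.sumCongr_apply, Sum.map_inl, doubleSubdivision_adj_inl_inl]
      exact and_congr e.map_adj_iff (not_congr this)
    all_goals simp

/-- Lifting connectivity to a double subdivision. -/
theorem IsConn.doubleSubdivision {U : Set (V ⊕ Fin 2)} (h : G.IsConn (Sum.inl ⁻¹' U))
    (h1 : ∀ i, Sum.inr i ∈ U → Sum.inl a ∈ U ∨ Sum.inl b ∈ U)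
    (h2 : Sum.inl a ∈ U → Sum.inl b ∈ U → ∃ i, Sum.inr i ∈ U) :
    (G.doubleSubdivision a b).IsConn U := by
  obtain ⟨⟨x, hx⟩, h⟩ := h
  refine ⟨⟨_, hx⟩, fun T hTU hne hT => ?_⟩
  have hl : ∀ v, Sum.inl v ∈ U → Sum.inl v ∈ T := by
    refine h (Sum.inl ⁻¹' T) (fun v hv => hTU hv) ?_ fun u hu v hv e => ?_
    · obtain ⟨v | i, ht⟩ := hne
      · exact ⟨v, ht⟩
      · rcases h1 i (hTU ht) with h | h
        · exact ⟨a, hT _ ht _ h (by simp)⟩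
        · exact ⟨b, hT _ ht _ h (by simp)⟩
    · by_cases huv : s(u, v) = s(a, b)
      · have hu' := hTU hu
        rcases Sym2.eq_iff.1 huv with ⟨rfl, rfl⟩ | ⟨rfl, rfl⟩
        · obtain ⟨i, hi⟩ := h2 hu' hv
          exact hT _ (hT _ hu _ hi (by simp)) _ hv (by simp)
        · obtain ⟨i, hi⟩ := h2 hv hu'
          exact hT _ (hT _ hu _ hi (by simp)) _ hv (by simp)
      · exact hT _ hu _ hv (doubleSubdivision_adj_inl_inl.2 ⟨e, huv⟩)
  rintro (v | i) hv
  · exact hl v hv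
  · rcases h1 i hv with h | h
    · exact hT _ (hl a h) _ hv (by simp)
    · exact hT _ (hl b h) _ hv (by simp)

/-- Projecting connectivity from a double subdivision. -/
theorem IsConn.of_doubleSubdivision {U : Set (V ⊕ Fin 2)}
    (h : (G.doubleSubdivision a b).IsConn U) (hab : G.Adj a b) (hne : (Sum.inl ⁻¹' U).Nonempty) :
    G.IsConn (Sum.inl ⁻¹' U) := by
  refine ⟨hne, fun T hTU ⟨t, ht⟩ hT => ?_⟩
  -- A new vertex counts as reached once `a` or `b` is; the edge `ab` of `G` then supplies the other
  -- end.
  have key : U ⊆ {x | x ∈ U ∧ Sum.elim (· ∈ T) (fun _ => a ∈ T ∨ b ∈ T) x} := by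
    refine h.2 _ (fun x hx => hx.1) ⟨.inl t, hTU ht, ht⟩ ?_
    rintro (u | i) ⟨hu, hu'⟩ (v | j) hv e
    · exact ⟨hv, hT u hu' v hv (doubleSubdivision_adj_inl_inl.1 e).1⟩
    · refine ⟨hv, ?_⟩
      rcases doubleSubdivision_adj_inl_inr.1 e with rfl | rfl
      · exact Or.inl hu'
      · exact Or.inr hu'
    · refine ⟨hv, ?_⟩
      rcases doubleSubdivision_adj_inr_inl.1 e with rfl | rfl
      · exact hu'.elim id fun hb => hT _ hb _ hv hab.symm
      · exact hu'.elim (fun ha => hT _ ha _ hv hab) id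
    · exact e.elim
  exact fun v hv => (key hv).2

/-- A connected set containing a new vertex and something else contains an end of the subdivided
edge. -/
theorem IsConn.mem_or_mem_of_inr_mem {U : Set (V ⊕ Fin 2)}
    (h : (G.doubleSubdivision a b).IsConn U) {i : Fin 2} (hi : Sum.inr i ∈ U)
    (hne : U ≠ {Sum.inr i}) : Sum.inl a ∈ U ∨ Sum.inl b ∈ U := by
  have : ∃ v ∈ U, v ≠ Sum.inr i := by
    by_contra! hc
    exact hne (Set.eq_singleton_iff_unique_mem.2 ⟨hi, hc⟩)
  obtain ⟨v, hv, hvi⟩ := this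
  obtain ⟨w | j, hw, e⟩ := h.exists_adj_of_mem hi hv hvi
  · rcases doubleSubdivision_adj_inr_inl.1 e with rfl | rfl
    · exact Or.inl hw
    · exact Or.inr hw
  · exact e.elim

/-- A model in `G` lifts to every double subdivision of `G`. -/
theorem IsModel.exists_lift {H : SimpleGraph W} {B : W → Set V} (h : H.IsModel G B) (a b : V) :
    ∃ B' : W → Set (V ⊕ Fin 2), H.IsModel (G.doubleSubdivision a b) B' ∧
      ∀ w, Sum.inl ⁻¹' B' w = B w := by
  classical
  -- `A` selects at most one branch set to receive both new vertices: the one containing `a` or,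
  -- failing that, the one containing `b`. Any use of the edge `ab` can then be rerouted through a
  -- new vertex.
  have hA : ∃ A : W → Prop, (∀ w, A w → a ∈ B w ∨ b ∈ B w) ∧ (∀ w w', A w → A w' → w = w') ∧
      (∀ w, a ∈ B w → b ∈ B w → A w) ∧
      (∀ w w', a ∈ B w → b ∈ B w' → A w ∨ A w') := by
    by_cases ha : ∃ w, a ∈ B w
    · exact ⟨fun w => a ∈ B w, fun w hw => Or.inl hw, fun w w' => h.eq_of_mem w w' a,
        fun w ha _ => ha, fun w w' ha _ => Or.inl ha⟩
    · exact ⟨fun w => b ∈ B w, fun w hw => Or.inr hw, fun w w' => h.eq_of_mem w w' b,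
        fun w _ hb => hb, fun w w' _ hb => Or.inr hb⟩
  obtain ⟨A, hA1, hA2, hA3, hA4⟩ := hA
  refine ⟨fun w => {x | Sum.elim (· ∈ B w) (fun _ => A w) x}, ⟨fun w => ?_, ?_, ?_⟩, fun w => rfl⟩
  · exact IsConn.doubleSubdivision (h.conn w) (fun i hi => hA1 w hi)
      (fun ha hb => ⟨0, hA3 w ha hb⟩)
  · rintro w w' (x | i) hx hx'
    · exact h.eq_of_mem w w' x hx hx'
    · exact hA2 w w' hx hx'
  · intro w w' e
    obtain ⟨p, hp, q, hq, hpq⟩ := h.adj w w' e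
    by_cases hs : s(p, q) = s(a, b)
    · rcases Sym2.eq_iff.1 hs with ⟨rfl, rfl⟩ | ⟨rfl, rfl⟩
      · rcases hA4 w w' hp hq with hw | hw
        · exact ⟨.inr 0, hw, .inl q, hq, by simp⟩
        · exact ⟨.inl p, hp, .inr 0, hw, by simp⟩
      · rcases hA4 w' w hq hp with hw | hw
        · exact ⟨.inl p, hp, .inr 0, hw, by simp⟩
        · exact ⟨.inr 0, hw, .inl q, hq, by simp⟩
    · exact ⟨.inl p, hp, .inl q, hq, doubleSubdivision_adj_inl_inl.2 ⟨hpq, hs⟩⟩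

/-- The branch sets of a double subdivision of a minor in a double subdivision. -/
def doubleSubdivisionModel (B : W → Set V) : W ⊕ Fin 2 → Set (V ⊕ Fin 2) :=
  Sum.elim (fun w => Sum.inl '' B w) (fun i => {Sum.inr i})

theorem IsModel.doubleSubdivision {H : SimpleGraph W} {B : W → Set V} (h : H.IsModel G B)
    {r s : W} (hrs : r ≠ s) (ha : a ∈ B r) (hb : b ∈ B s) :
    (H.doubleSubdivision r s).IsModel (G.doubleSubdivision a b) (doubleSubdivisionModel B) := by
  have har : ∀ w, a ∈ B w → w = r := fun w hw => h.eq_of_mem w r a hw ha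
  have hbs : ∀ w, b ∈ B w → w = s := fun w hw => h.eq_of_mem w s b hw hb
  refine ⟨?_, ?_, ?_⟩
  · rintro (w | i)
    · refine IsConn.doubleSubdivision ?_ ?_ ?_
      · convert h.conn w using 1
        ext; simp [doubleSubdivisionModel]
      · simp [doubleSubdivisionModel]
      · intro h1 h2
        exact (hrs ((har w (by simpa [doubleSubdivisionModel] using h1)).symm.trans
          (hbs w (by simpa [doubleSubdivisionModel] using h2)))).elim
    · exact isConn_singleton _ _
  · rintro (w | i) (w' | j) (x | k) <;> simp [doubleSubdivisionModel]
    · exact h.eq_of_mem w w' x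
    · rintro rfl rfl; rfl
  · rintro (w | i) (w' | j) e
    · obtain ⟨e, hne⟩ := doubleSubdivision_adj_inl_inl.1 e
      obtain ⟨p, hp, q, hq, hpq⟩ := h.adj w w' e
      refine ⟨.inl p, ⟨p, hp, rfl⟩, .inl q, ⟨q, hq, rfl⟩,
        doubleSubdivision_adj_inl_inl.2 ⟨hpq, fun hs => hne ?_⟩⟩
      rcases Sym2.eq_iff.1 hs with ⟨rfl, rfl⟩ | ⟨rfl, rfl⟩
      · rw [har _ hp, hbs _ hq]
      · rw [har _ hq, hbs _ hp, Sym2.eq_swap]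
    · rcases doubleSubdivision_adj_inl_inr.1 e with rfl | rfl
      · exact ⟨.inl a, ⟨a, ha, rfl⟩, .inr j, rfl, by simp⟩
      · exact ⟨.inl b, ⟨b, hb, rfl⟩, .inr j, rfl, by simp⟩
    · rcases doubleSubdivision_adj_inr_inl.1 e with rfl | rfl
      · exact ⟨.inr i, rfl, .inl a, ⟨a, ha, rfl⟩, by simp⟩
      · exact ⟨.inr i, rfl, .inl b, ⟨b, hb, rfl⟩, by simp⟩
    · exact e.elim

/-- A model in a double subdivision each of whose branch sets contains an old vertex projects. -/
theorem IsModel.of_doubleSubdivision {H : SimpleGraph W} {B : W → Set (V ⊕ Fin 2)}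
    (h : H.IsModel (G.doubleSubdivision a b) B) (hab : G.Adj a b)
    (hne : ∀ w, (Sum.inl ⁻¹' B w).Nonempty) : H.IsModel G (fun w => Sum.inl ⁻¹' B w) := by
  -- A branch set containing a new vertex and an old one contains an end of `ab`, so contact through
  -- the new vertex can be replaced by the edge `ab`.
  have key : ∀ w w' i v, H.Adj w w' → Sum.inr i ∈ B w → Sum.inl v ∈ B w' → (v = a ∨ v = b) →
      ∃ u, Sum.inl u ∈ B w ∧ G.Adj u v := by
    intro w w' i v e hi hv hv'
    have hu := (h.conn w).mem_or_mem_of_inr_mem hi (fun hc => by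
      obtain ⟨x, hx⟩ := hne w
      rw [hc] at hx
      simp at hx)
    have hd : ∀ x, x ∈ B w → x ∈ B w' → False :=
      fun x hx hx' => e.ne (h.eq_of_mem w w' x hx hx')
    rcases hv' with rfl | rfl <;> rcases hu with hu | hu
    · exact (hd _ hu hv).elim
    · exact ⟨b, hu, hab.symm⟩
    · exact ⟨a, hu, hab⟩
    · exact (hd _ hu hv).elim
  refine ⟨fun w => (h.conn w).of_doubleSubdivision hab (hne w),
    fun w w' x hx hx' => h.eq_of_mem w w' _ hx hx', fun w w' e => ?_⟩
  obtain ⟨p | i, hp, q | j, hq, hpq⟩ := h.adj w w' e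
  · exact ⟨p, hp, q, hq, (doubleSubdivision_adj_inl_inl.1 hpq).1⟩
  · obtain ⟨u, hu, huv⟩ := key w' w j p e.symm hq hp (doubleSubdivision_adj_inl_inr.1 hpq)
    exact ⟨p, hp, u, hu, huv.symm⟩
  · obtain ⟨u, hu, huv⟩ := key w w' i q e hp hq (doubleSubdivision_adj_inr_inl.1 hpq)
    exact ⟨u, hu, q, hq, huv⟩
  · exact hpq.elim

end DoubleSubdivision

/-! ### Invariants of generalised triangles -/

/-- The graph is connected, and it remains so when any vertex or the two ends of any edge are
deleted. -/
structure EdgeRobust (G : SimpleGraph V) : Prop where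
  univ : G.IsConn Set.univ
  vertex : ∀ v, G.IsConn {v}ᶜ
  edge : ∀ u v, G.Adj u v → G.IsConn {u, v}ᶜ

/-- `G` is the union of two connected parts `D 0` and `D 1`, both attached to `y` and to `z`, and
of the vertices `s`, `y`, `z`. -/
structure IsSplit (G : SimpleGraph V) (s y z : V) (D : Fin 2 → Set V) : Prop where
  conn : ∀ k, G.IsConn (D k)
  cover : ∀ v, v ≠ s → v ≠ y → v ≠ z → ∃ k, v ∈ D k
  avoid : ∀ k, s ∉ D k ∧ y ∉ D k ∧ z ∉ D k
  sep : ∀ i j, ∀ u ∈ D i, ∀ v ∈ D j, u = v ∨ G.Adj u v → i = j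
  left : ∀ k, ∃ d ∈ D k, G.Adj y d
  right : ∀ k, ∃ d ∈ D k, G.Adj z d

/-- For every vertex of degree two, its neighbours are nonadjacent and form a cut with three
components. -/
def DegreeTwoSplit (G : SimpleGraph V) : Prop :=
  ∀ s y z, y ≠ z → (∀ u, G.Adj s u ↔ u = y ∨ u = z) → ¬ G.Adj y z ∧ ∃ D, G.IsSplit s y z D

/-- `u` has two neighbours other than `v`. -/
def Thick (G : SimpleGraph V) (u v : V) : Prop :=
  ∃ c d, c ≠ d ∧ c ≠ v ∧ d ≠ v ∧ G.Adj u c ∧ G.Adj u d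

/-- `K₃` with two of its edges double subdivided. -/
abbrev twoDoubled : SimpleGraph ((Fin 3 ⊕ Fin 2) ⊕ Fin 2) :=
  ((⊤ : SimpleGraph (Fin 3)).doubleSubdivision 1 2).doubleSubdivision (.inl 0) (.inl 2)

/-- There is a model of `twoDoubled` whose simple edge is realised by `uv`. -/
def HasRootedModel (G : SimpleGraph V) (u v : V) : Prop :=
  ∃ B, twoDoubled.IsModel G B ∧ u ∈ B (.inl (.inl 0)) ∧ v ∈ B (.inl (.inl 1))

theorem EdgeRobust.exists_adj {G : SimpleGraph V} (h : G.EdgeRobust) {u v : V} (e : G.Adj u v) :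
    ∃ c, c ≠ v ∧ G.Adj u c := by
  obtain ⟨w, hw⟩ := (h.edge u v e).1
  have hw : w ≠ u ∧ w ≠ v := by simpa using hw
  obtain ⟨c, hc, hc'⟩ := (h.vertex v).exists_adj_of_mem (u := u) (v := w) (by simpa using e.ne)
    (by simpa using hw.2) hw.1
  exact ⟨c, by simpa using hc, hc'⟩

/-- The dichotomy behind the induction: robustness forces degree at least two, so an end that is not
thick has exactly two neighbours. -/
theorem EdgeRobust.thick_or {G : SimpleGraph V} (h : G.EdgeRobust) {u v : V} (e : G.Adj u v) :
    G.Thick u v ∨ ∃ c, c ≠ v ∧ ∀ x, G.Adj u x ↔ x = v ∨ x = c := by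
  obtain ⟨c, hc, hc'⟩ := h.exists_adj e
  by_cases hd : ∃ d, d ≠ c ∧ d ≠ v ∧ G.Adj u d
  · obtain ⟨d, h1, h2, h3⟩ := hd
    exact Or.inl ⟨c, d, h1.symm, hc, h2, hc', h3⟩
  · push Not at hd
    refine Or.inr ⟨c, hc, fun x => ⟨fun hx => ?_, ?_⟩⟩
    · by_contra! hne
      exact hd x hne.2 hne.1 hx
    · rintro (rfl | rfl) <;> assumption

theorem EdgeRobust.map_iso {G : SimpleGraph V} {G' : SimpleGraph V'} (h : G.EdgeRobust)
    (e : G ≃g G') : G'.EdgeRobust := by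
  have he : ∀ x v, e x = v ↔ x = e.symm v := fun x v => by
    constructor
    · rintro rfl; simp
    · rintro rfl; simp
  refine ⟨IsConn.map_iso e h.univ, fun v => IsConn.map_iso e ?_,
    fun u v huv => IsConn.map_iso e ?_⟩
  · convert h.vertex (e.symm v) using 1
    ext x
    simp [he]
  · convert h.edge (e.symm u) (e.symm v) (e.symm.map_adj_iff.2 huv) using 1
    ext x
    simp [he]

theorem HasRootedModel.symm {G : SimpleGraph V} {u v : V} (h : G.HasRootedModel u v) :
    G.HasRootedModel v u := by
  obtain ⟨B, hB, hu, hv⟩ := h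
  -- A symmetry of `twoDoubled`: it swaps the ends of the simple edge 01 and, with them, the doubled
  -- edges 12 and 02.
  let f : (Fin 3 ⊕ Fin 2) ⊕ Fin 2 → (Fin 3 ⊕ Fin 2) ⊕ Fin 2
    | .inl (.inl 0) => .inl (.inl 1)
    | .inl (.inl 1) => .inl (.inl 0)
    | .inl (.inl 2) => .inl (.inl 2)
    | .inl (.inr k) => .inr k
    | .inr k => .inl (.inr k)
  exact ⟨_, hB.comp f (by decide) (by decide), hv, hu⟩

theorem HasRootedModel.lift {G : SimpleGraph V} {u v : V} (h : G.HasRootedModel u v) (a b : V) :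
    (G.doubleSubdivision a b).HasRootedModel (.inl u) (.inl v) := by
  obtain ⟨B, hB, hu, hv⟩ := h
  obtain ⟨B', hB', h⟩ := hB.exists_lift a b
  refine ⟨B', hB', ?_, ?_⟩
  · rw [← h] at hu; exact hu
  · rw [← h] at hv; exact hv

theorem HasRootedModel.h0_isMinor {G : SimpleGraph V} {a b : V} (h : G.HasRootedModel a b) :
    H0.IsMinor (G.doubleSubdivision a b) := by
  obtain ⟨B, hB, hu, hv⟩ := h
  -- The lifted model doubles the edges 12, 02, 01 in this order, while `H0` doubles 01, 12, 02; `f`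
  -- permutes the pairs of new vertices accordingly.
  let f : ((Fin 3 ⊕ Fin 2) ⊕ Fin 2) ⊕ Fin 2 → ((Fin 3 ⊕ Fin 2) ⊕ Fin 2) ⊕ Fin 2
    | .inl (.inl (.inl i)) => .inl (.inl (.inl i))
    | .inl (.inl (.inr k)) => .inr k
    | .inl (.inr k) => .inl (.inl (.inr k))
    | .inr k => .inl (.inr k)
  refine isMinor_iff_exists_isModel.2 ⟨_, (hB.doubleSubdivision (by decide) hu hv).comp f
    (by decide) ?_⟩
  unfold H0
  decide

/-! ### Robustness and splits under double subdivision -/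

section DoubleSubdivision

variable {G : SimpleGraph V} {a b : V}

/-- No edge contains two new vertices or equals `ab`. So some new vertex survives each deletion, and
a surviving new vertex still has a surviving neighbour; connectivity then lifts from `G`. -/
theorem EdgeRobust.doubleSubdivision (h : G.EdgeRobust) (hab : G.Adj a b) :
    (G.doubleSubdivision a b).EdgeRobust := by
  have hne := hab.ne
  have hmix : ∀ (u : V) (j : Fin 2), u = a ∨ u = b →
      (G.doubleSubdivision a b).IsConn {Sum.inl u, Sum.inr j}ᶜ := by
    intro u j hu
    refine IsConn.doubleSubdivision ?_ ?_ ?_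
    · convert h.vertex u using 1
      ext; simp
    · intro _ _
      simp
      grind
    · exact fun _ _ => ⟨j + 1, by simp⟩
  refine ⟨IsConn.doubleSubdivision h.univ (fun _ _ => Or.inl trivial) fun _ _ => ⟨0, trivial⟩,
    ?_, ?_⟩
  · rintro (v | i)
    · refine IsConn.doubleSubdivision ?_ ?_ ?_
      · convert h.vertex v using 1
        ext; simp
      · intro _ _
        simp
        grind
      · exact fun _ _ => ⟨0, by simp⟩
    · refine IsConn.doubleSubdivision ?_ ?_ ?_
      · convert h.univ using 1
        ext; simp
      · intro i _; left; simp
      · intro _ _; exact ⟨i + 1, by simp⟩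
  · rintro (u | i) (v | j) e
    · obtain ⟨e, huv⟩ := doubleSubdivision_adj_inl_inl.1 e
      refine IsConn.doubleSubdivision ?_ ?_ ?_
      · convert h.edge u v e using 1
        ext; simp
      · intro i _
        simp
        grind
      · exact fun _ _ => ⟨0, by simp⟩
    · exact hmix u j (doubleSubdivision_adj_inl_inr.1 e)
    · rw [Set.pair_comm]
      exact hmix v i (doubleSubdivision_adj_inr_inl.1 e)
    · exact e.elim

/-- For a new vertex, the parts are the other new vertex and the old graph without `a` and `b`. For
an old vertex, the old parts absorb the new vertices. The vertices `a` and `b` themselves now have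
degree at least three. -/
theorem DegreeTwoSplit.doubleSubdivision (hs : G.DegreeTwoSplit) (h : G.EdgeRobust)
    (hab : G.Adj a b) : (G.doubleSubdivision a b).DegreeTwoSplit := by
  have hne := hab.ne
  have hnew : ∀ (i : Fin 2) (y z : V), y ≠ z → (∀ u, u = a ∨ u = b ↔ u = y ∨ u = z) →
      ∃ D, (G.doubleSubdivision a b).IsSplit (.inr i) (.inl y) (.inl z) D := by
    intro i y z hyz hN
    have hyz' : G.Adj y z := by
      have := hN y; have := hN z; have := hN a; have := hN b
      have := hab.symm
      grind
    have hins : ∀ x w, G.Adj x w → (∃ d, (d ≠ x ∧ d ≠ w) ∧ G.Adj x d ∧ s(x, d) ≠ s(x, w)) := by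
      intro x w e
      obtain ⟨d, hd, hd'⟩ := h.exists_adj e
      exact ⟨d, ⟨hd'.ne', hd⟩, hd', by simpa [e.ne] using hd⟩
    have hsym : s(a, b) = s(y, z) := by
      have := hN y; have := hN z; have := hN a; have := hN b
      rw [Sym2.eq_iff]
      grind
    refine ⟨![{.inr (i + 1)}, Sum.inl '' {y, z}ᶜ], ?_, ?_, ?_, ?_, ?_, ?_⟩
    · rw [Fin.forall_fin_two]
      refine ⟨isConn_singleton _ _, IsConn.doubleSubdivision ?_ ?_ ?_⟩
      · convert h.edge y z hyz' using 1
        ext; simp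
      · simp
      · have := hN a
        simp; grind
    · rintro (v | j) h1 h2 h3
      · exact ⟨1, by simp at *; grind⟩
      · refine ⟨0, ?_⟩
        have : j ≠ i := by simpa using h1
        simp; lia
    · rw [Fin.forall_fin_two]
      simp
    · rw [Fin.forall_fin_two, Fin.forall_fin_two, Fin.forall_fin_two]
      have := hN a; have := hN b
      simp; grind
    · rw [Fin.forall_fin_two]
      refine ⟨⟨_, rfl, by have := hN y; simp; grind⟩, ?_⟩
      obtain ⟨d, hd, hd', hd''⟩ := hins y z hyz'
      exact ⟨.inl d, by simpa using hd, by simp [hsym]; grind⟩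
    · rw [Fin.forall_fin_two]
      refine ⟨⟨_, rfl, by have := hN z; simp; grind⟩, ?_⟩
      obtain ⟨d, hd, hd', hd''⟩ := hins z y hyz'.symm
      exact ⟨.inl d, by simpa [and_comm] using hd, by
        rw [doubleSubdivision_adj_inl_inl, hsym, Sym2.eq_swap (a := y)]; exact ⟨hd', hd''⟩⟩
  have hend : ∀ s w, G.Adj s w → s(s, w) = s(a, b) → ∀ y z,
      ¬ (∀ u, (G.doubleSubdivision a b).Adj (.inl s) u ↔ u = y ∨ u = z) := by
    intro s w e hsw y z hN
    obtain ⟨c, hc, hc'⟩ := h.exists_adj e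
    have h0 := hN (.inr 0)
    have h1 := hN (.inr 1)
    have h2 := hN (.inl c)
    have : s = a ∨ s = b := by rw [Sym2.eq_iff] at hsw; tauto
    have hcs : s(s, c) ≠ s(a, b) := by
      rw [← hsw]; simpa [e.ne] using hc
    simp only [doubleSubdivision_adj_inl_inr, doubleSubdivision_adj_inl_inl, this, hc', hcs, ne_eq,
      not_false_eq_true, and_self, true_iff] at h0 h1 h2
    grind
  rintro (s | i) y z hyz hN
  · have hsa : s ≠ a := by
      rintro rfl; exact hend s b hab rfl y z hN
    have hsb : s ≠ b := by
      rintro rfl; exact hend s a hab.symm Sym2.eq_swap y z hN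
    rcases y with y | i
    swap
    · have := (hN (.inr i)).2 (Or.inl rfl)
      simp [hsa, hsb] at this
    rcases z with z | i
    swap
    · have := (hN (.inr i)).2 (Or.inr rfl)
      simp [hsa, hsb] at this
    have hN' : ∀ u, G.Adj s u ↔ u = y ∨ u = z := by
      intro u
      have := hN (.inl u)
      simpa [hsa, hsb] using this
    have hyz' : y ≠ z := fun h => hyz (h ▸ rfl)
    obtain ⟨hnadj, D, hD⟩ := hs s y z hyz' hN'
    have hatt : ∀ y (S : Set V), (∃ d ∈ S, G.Adj y d) →
        ∃ d ∈ {x : V ⊕ Fin 2 | Sum.elim (· ∈ S) (fun _ => a ∈ S ∨ b ∈ S) x},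
          (G.doubleSubdivision a b).Adj (.inl y) d := by
      rintro y S ⟨d, hd, e⟩
      by_cases hyd : s(y, d) = s(a, b)
      · refine ⟨.inr 0, ?_, ?_⟩ <;> rcases Sym2.eq_iff.1 hyd with ⟨rfl, rfl⟩ | ⟨rfl, rfl⟩ <;>
          simp [hd]
      · exact ⟨.inl d, hd, doubleSubdivision_adj_inl_inl.2 ⟨e, hyd⟩⟩
    refine ⟨fun e => hnadj (doubleSubdivision_adj_inl_inl.1 e).1,
      fun k => {x | Sum.elim (· ∈ D k) (fun _ => a ∈ D k ∨ b ∈ D k) x}, ?_, ?_, ?_, ?_, ?_, ?_⟩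
    · exact fun k => IsConn.doubleSubdivision (hD.conn k) (fun _ hi => hi)
        (fun ha _ => ⟨0, Or.inl ha⟩)
    · rintro (v | i) h1 h2 h3
      · exact hD.cover v (by simpa using h1) (by simpa using h2) (by simpa using h3)
      -- If neither `a` nor `b` lay in a part, the edge `ab` would join `y` to `z`, which are
      -- nonadjacent.
      · by_contra! hc
        have ha : a = y ∨ a = z := by
          by_contra! h
          obtain ⟨k, hk⟩ := hD.cover a hsa.symm h.1 h.2
          exact hc k (Or.inl hk)
        have hb : b = y ∨ b = z := by
          by_contra! h
          obtain ⟨k, hk⟩ := hD.cover b hsb.symm h.1 h.2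
          exact hc k (Or.inr hk)
        have := hab.symm
        grind
    · exact fun k => hD.avoid k
    · rintro i j (u | k) hu (v | l) hv e
      · refine hD.sep i j u hu v hv ?_
        simp at e; tauto
      · have e : u = a ∨ u = b := by simpa using e
        have := hD.sep i j u hu
        have hba := hab.symm
        rcases e with rfl | rfl <;> rcases hv with hv | hv <;> exact this _ hv (by tauto)
      · have e : v = a ∨ v = b := by simpa using e
        have := fun u hu => hD.sep i j u hu v hv
        have hba := hab.symm
        rcases e with rfl | rfl <;> rcases hu with hu | hu <;> exact this _ hu (by tauto)
      · have hba := hab.symm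
        rcases hu with hu | hu <;> rcases hv with hv | hv <;>
          exact hD.sep i j _ hu _ hv (by tauto)
    · exact fun k => hatt y _ (hD.left k)
    · exact fun k => hatt z _ (hD.right k)
  · rcases y with y | j
    swap
    · exact ((hN (.inr j)).2 (Or.inl rfl)).elim
    rcases z with z | j
    swap
    · exact ((hN (.inr j)).2 (Or.inr rfl)).elim
    have hN' : ∀ u, u = a ∨ u = b ↔ u = y ∨ u = z := by
      intro u
      simpa using hN (.inl u)
    have hyz' : y ≠ z := fun h => hyz (h ▸ rfl)
    refine ⟨fun e => (doubleSubdivision_adj_inl_inl.1 e).2 ?_, hnew i y z hyz' hN'⟩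
    have := hN' y; have := hN' z; have := hN' a; have := hN' b
    rw [Sym2.eq_iff]
    grind

/-! ### Rooted models at thick edges -/

/-- Every edge both of whose ends have degree at least three is the root of a model of
`twoDoubled`. -/
def ThickEdgesRooted (G : SimpleGraph V) : Prop :=
  ∀ u v, G.Adj u v → G.Thick u v → G.Thick v u → G.HasRootedModel u v

/-- The triangle vertices 0, 1, 2 are realised by `a`, `v`, `b`. The two parts of the split double
the edge `vb`, and the new vertices double `ab`, leaving `av` simple. -/
theorem IsSplit.hasRootedModel {v : V} {D : Fin 2 → Set V} (hD : G.IsSplit a v b D)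
    (hav : G.Adj a v) (hab : G.Adj a b) (hvb : v ≠ b) :
    (G.doubleSubdivision a b).HasRootedModel (.inl a) (.inl v) := by
  have hB : ((⊤ : SimpleGraph (Fin 3)).doubleSubdivision 1 2).IsModel G
      (Sum.elim ![{a}, {v}, {b}] D) := by
    have havoid := hD.avoid
    have hnv := hav.ne
    have hnb := hab.ne
    refine ⟨?_, ?_, ?_⟩
    · rintro (i | k)
      · fin_cases i <;> exact isConn_singleton _ _
      · exact hD.conn k
    · rintro (i | k) (j | l) x hx hx'
      · congr 1
        fin_cases i <;> fin_cases j <;> simp_all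
      · have := havoid l
        fin_cases i <;> simp_all
      · have := havoid k
        fin_cases j <;> simp_all
      · exact congrArg _ (hD.sep k l x hx x hx' (Or.inl rfl))
    · have hlr : ∀ (i : Fin 3) (k : Fin 2), i = 1 ∨ i = 2 →
          ∃ p ∈ (![{a}, {v}, {b}] : Fin 3 → Set V) i, ∃ q ∈ D k, G.Adj p q := by
        rintro i k (rfl | rfl)
        · exact ⟨v, rfl, hD.left k⟩
        · exact ⟨b, rfl, hD.right k⟩
      rintro (i | k) (j | l) e
      · obtain ⟨e, hij⟩ := doubleSubdivision_adj_inl_inl.1 e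
        fin_cases i <;> fin_cases j
        · exact absurd rfl e
        · exact ⟨a, rfl, v, rfl, hav⟩
        · exact ⟨a, rfl, b, rfl, hab⟩
        · exact ⟨v, rfl, a, rfl, hav.symm⟩
        · exact absurd rfl e
        · exact absurd rfl hij
        · exact ⟨b, rfl, a, rfl, hab.symm⟩
        · exact absurd Sym2.eq_swap hij
        · exact absurd rfl e
      · exact hlr i l (doubleSubdivision_adj_inl_inr.1 e)
      · obtain ⟨p, hp, q, hq, e⟩ := hlr j k (doubleSubdivision_adj_inr_inl.1 e)
        exact ⟨q, hq, p, hp, e.symm⟩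
      · exact e.elim
  exact ⟨_, hB.doubleSubdivision (by decide) (show a ∈ {a} from rfl) (show b ∈ {b} from rfl),
    ⟨a, rfl, rfl⟩, ⟨v, rfl, rfl⟩⟩

/-- New vertices have degree two, so a thick edge is old. If both ends were thick before, the old
model lifts; otherwise an end has just gained degree, hence lies on `ab`, and its split provides the
model. -/
theorem ThickEdgesRooted.doubleSubdivision (hr : G.ThickEdgesRooted) (hs : G.DegreeTwoSplit)
    (h : G.EdgeRobust) (hab : G.Adj a b) : (G.doubleSubdivision a b).ThickEdgesRooted := by
  have hinr : ∀ i v, (v = a ∨ v = b) →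
      ¬ (G.doubleSubdivision a b).Thick (.inr i) (.inl v) := by
    rintro i v hv ⟨c | k, d | l, h1, h2, h3, h4, h5⟩ <;> simp at h4 h5
    simp at h1 h2 h3
    grind
  have key : ∀ u v, G.Adj u v → s(u, v) ≠ s(a, b) →
      (G.doubleSubdivision a b).Thick (.inl u) (.inl v) →
      G.Thick u v ∨ (G.doubleSubdivision a b).HasRootedModel (.inl u) (.inl v) := by
    intro u v e huv ht
    refine (h.thick_or e).imp_right ?_
    rintro ⟨c, hcv, hN⟩
    obtain ⟨-, D, hD⟩ := hs u v c hcv.symm hN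
    have huc : G.Adj u c := (hN c).2 (Or.inr rfl)
    have hr := hD.hasRootedModel e huc hcv.symm
    have hu : u = a ∨ u = b := by
      by_contra! hu
      obtain ⟨x | i, y | j, h1, h2, h3, h4, h5⟩ := ht <;> simp [hu] at h4 h5
      rw [hN] at h4 h5
      simp at h1 h2 h3
      grind
    rcases hu with rfl | rfl
    · obtain rfl : b = c := ((hN b).1 hab).resolve_left fun hb => huv (hb ▸ rfl)
      exact hr
    · obtain rfl : a = c :=
        ((hN a).1 hab.symm).resolve_left fun hb => huv (hb ▸ Sym2.eq_swap)
      rw [doubleSubdivision_comm]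
      exact hr
  rintro (u | i) (v | j) e hu hv
  · obtain ⟨e, huv⟩ := doubleSubdivision_adj_inl_inl.1 e
    rcases key u v e huv hu with hu | hu
    · rcases key v u e.symm (by rwa [Sym2.eq_swap]) hv with hv | hv
      · exact (hr u v e hu hv).lift a b
      · exact hv.symm
    · exact hu
  · exact (hinr j u (doubleSubdivision_adj_inl_inr.1 e) hv).elim
  · exact (hinr i v (doubleSubdivision_adj_inr_inl.1 e) hu).elim
  · exact e.elim

end DoubleSubdivision

/-! ### Thick cuts -/

/-- Deleting `x` and `y` separates `C` from `D`, where `C` is connected and both `x` and `y` have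
two neighbours in `C`. -/
structure IsThickCut (G : SimpleGraph V) (x y : V) (C D : Set V) : Prop where
  ne : x ≠ y
  conn : G.IsConn C
  nonempty : D.Nonempty
  cover : ∀ v, v ≠ x → v ≠ y → v ∈ C ∨ v ∈ D
  avoid_left : x ∉ C ∧ x ∉ D
  avoid_right : y ∉ C ∧ y ∉ D
  sep : ∀ u ∈ C, ∀ v ∈ D, u ≠ v ∧ ¬ G.Adj u v
  left : ∃ c ∈ C, ∃ d ∈ C, c ≠ d ∧ G.Adj x c ∧ G.Adj x d
  right : ∃ c ∈ C, ∃ d ∈ C, c ≠ d ∧ G.Adj y c ∧ G.Adj y d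

/-- The graph has a cut of two vertices both of which have two neighbours in the same bridge. -/
def HasThickCut (G : SimpleGraph V) : Prop := ∃ x y C D, G.IsThickCut x y C D

theorem IsThickCut.symm {G : SimpleGraph V} {x y : V} {C D : Set V} (h : G.IsThickCut x y C D) :
    G.IsThickCut y x C D :=
  ⟨h.ne.symm, h.conn, h.nonempty, fun v h1 h2 => h.cover v h2 h1, h.avoid_right, h.avoid_left,
    h.sep, h.right, h.left⟩

theorem HasThickCut.map_iso {G : SimpleGraph V} {G' : SimpleGraph V'} (h : G.HasThickCut)
    (e : G ≃g G') : G'.HasThickCut := by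
  obtain ⟨x, y, C, D, h⟩ := h
  refine ⟨e x, e y, e.symm ⁻¹' C, e.symm ⁻¹' D, fun hc => h.ne (e.injective hc),
    IsConn.map_iso e ?_, ?_, ?_, by simpa using h.avoid_left, by simpa using h.avoid_right, ?_, ?_,
    ?_⟩
  · convert h.conn using 1
    ext; simp
  · obtain ⟨d, hd⟩ := h.nonempty
    exact ⟨e d, by simpa using hd⟩
  · intro v h1 h2
    exact h.cover _ (by rintro rfl; simp at h1) (by rintro rfl; simp at h2)
  · intro u hu v hv
    obtain ⟨h1, h2⟩ := h.sep _ hu _ hv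
    exact ⟨fun hc => h1 (hc ▸ rfl), fun hc => h2 (e.symm.map_adj_iff.2 hc)⟩
  · obtain ⟨c, hc, d, hd, hcd, h1, h2⟩ := h.left
    exact ⟨e c, by simpa using hc, e d, by simpa using hd, fun h => hcd (e.injective h),
      e.map_adj_iff.2 h1, e.map_adj_iff.2 h2⟩
  · obtain ⟨c, hc, d, hd, hcd, h1, h2⟩ := h.right
    exact ⟨e c, by simpa using hc, e d, by simpa using hd, fun h => hcd (e.injective h),
      e.map_adj_iff.2 h1, e.map_adj_iff.2 h2⟩

section DoubleSubdivision

variable {G : SimpleGraph V} {a b : V}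

/-- The new vertices join `C` if an end of `ab` lies there, and `D` otherwise. If the edge from a
cut vertex into `C` is the subdivided one, the two new vertices themselves are the required
neighbours. -/
theorem HasThickCut.doubleSubdivision (h : G.HasThickCut) (hab : G.Adj a b) :
    (G.doubleSubdivision a b).HasThickCut := by
  obtain ⟨x, y, C, D, h⟩ := h
  have hba := hab.symm
  have hnbr : ∀ x, x ∉ C → (∃ c ∈ C, ∃ d ∈ C, c ≠ d ∧ G.Adj x c ∧ G.Adj x d) →
      ∃ c ∈ {z : V ⊕ Fin 2 | Sum.elim (· ∈ C) (fun _ => a ∈ C ∨ b ∈ C) z},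
      ∃ d ∈ {z : V ⊕ Fin 2 | Sum.elim (· ∈ C) (fun _ => a ∈ C ∨ b ∈ C) z}, c ≠ d ∧
        (G.doubleSubdivision a b).Adj (.inl x) c ∧ (G.doubleSubdivision a b).Adj (.inl x) d := by
    rintro x hx ⟨c, hc, d, hd, hcd, h1, h2⟩
    by_cases hs : (x = a ∨ x = b) ∧ (a ∈ C ∨ b ∈ C)
    · exact ⟨.inr 0, hs.2, .inr 1, hs.2, by simp, by simpa using hs.1, by simpa using hs.1⟩
    · have key : ∀ c ∈ C, s(x, c) ≠ s(a, b) := by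
        intro c hc he
        rcases Sym2.eq_iff.1 he with ⟨rfl, rfl⟩ | ⟨rfl, rfl⟩ <;> simp [hc] at hs
      exact ⟨.inl c, hc, .inl d, hd, by simpa using hcd,
        doubleSubdivision_adj_inl_inl.2 ⟨h1, key c hc⟩,
        doubleSubdivision_adj_inl_inl.2 ⟨h2, key d hd⟩⟩
  refine ⟨.inl x, .inl y, {z | Sum.elim (· ∈ C) (fun _ => a ∈ C ∨ b ∈ C) z},
    {z | Sum.elim (· ∈ D) (fun _ => ¬ (a ∈ C ∨ b ∈ C)) z}, ?_, ?_, ?_, ?_, ?_, ?_, ?_, ?_, ?_⟩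
  · simpa using h.ne
  · exact IsConn.doubleSubdivision h.conn (fun _ hi => hi) (fun ha _ => ⟨0, Or.inl ha⟩)
  · obtain ⟨d, hd⟩ := h.nonempty
    exact ⟨.inl d, hd⟩
  · rintro (v | i) h1 h2
    · exact h.cover v (by simpa using h1) (by simpa using h2)
    · exact em _
  · exact h.avoid_left
  · exact h.avoid_right
  · rintro (u | i) hu (v | j) hv
    · have := h.sep u hu v hv
      simp [this]
    · refine ⟨by simp, fun e => hv ?_⟩
      rcases doubleSubdivision_adj_inl_inr.1 e with rfl | rfl
      · exact Or.inl hu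
      · exact Or.inr hu
    · refine ⟨by simp, fun e => ?_⟩
      have := fun u hu => h.sep u hu v hv
      rcases doubleSubdivision_adj_inr_inl.1 e with rfl | rfl <;> rcases hu with hu | hu <;>
        have := this _ hu <;> tauto
    · exact absurd hu hv
  · exact hnbr x h.avoid_left.1 h.left
  · exact hnbr y h.avoid_right.1 h.right

theorem Thick.hasThickCut (h : G.EdgeRobust) (hab : G.Adj a b) (ha : G.Thick a b)
    (hb : G.Thick b a) : (G.doubleSubdivision a b).HasThickCut := by
  refine ⟨.inl a, .inl b, Sum.inl '' {a, b}ᶜ, Set.range Sum.inr, ?_, ?_, ?_, ?_, ?_, ?_, ?_, ?_,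
    ?_⟩
  · simpa using hab.ne
  · refine IsConn.doubleSubdivision ?_ ?_ ?_
    · convert h.edge a b hab using 1
      ext; simp
    · simp
    · simp
  · exact ⟨.inr 0, 0, rfl⟩
  · rintro (v | i) h1 h2 <;> simp at *
    tauto
  · simp
  · simp
  · rintro _ ⟨u, hu, rfl⟩ _ ⟨i, rfl⟩
    simpa using hu
  · obtain ⟨c, d, hcd, h1, h2, h3, h4⟩ := ha
    exact ⟨.inl c, ⟨c, by simpa using ⟨h3.ne', h1⟩, rfl⟩, .inl d,
      ⟨d, by simpa using ⟨h4.ne', h2⟩, rfl⟩, by simpa using hcd,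
      by simp [h3, h1, h3.ne'], by simp [h4, h2, h4.ne']⟩
  · obtain ⟨c, d, hcd, h1, h2, h3, h4⟩ := hb
    exact ⟨.inl c, ⟨c, by simpa using ⟨h1, h3.ne'⟩, rfl⟩, .inl d,
      ⟨d, by simpa using ⟨h2, h4.ne'⟩, rfl⟩, by simpa using hcd,
      by simp [h3, h1, h3.ne', hab.ne'], by simp [h4, h2, h4.ne', hab.ne']⟩

/-- Both neighbours of a new vertex in the cut lie in `C`, so `y` alone would separate `D`, against
robustness. -/
theorem IsThickCut.false_of_left_inr (h : (G.doubleSubdivision a b).EdgeRobust) {i : Fin 2}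
    {y : V ⊕ Fin 2} {C D : Set (V ⊕ Fin 2)}
    (hC : (G.doubleSubdivision a b).IsThickCut (.inr i) y C D) : False := by
  have hall : ∀ v, (G.doubleSubdivision a b).Adj (.inr i) v → v ∈ C := by
    obtain ⟨c | k, hc, d | l, hd, hcd, h1, h2⟩ := hC.left <;> simp at h1 h2
    rintro (v | j) e <;> simp at e
    grind
  refine hC.avoid_left.2 ((h.vertex y).2 D (fun d hd hdy => hC.avoid_right.2 (hdy ▸ hd))
    hC.nonempty (fun u hu v hv e => ?_) (by simpa using hC.ne))
  by_cases hvx : v = .inr i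
  · exact ((hC.sep u (hall u (hvx ▸ e.symm)) u hu).1 rfl).elim
  · exact (hC.cover v hvx hv).resolve_left fun hvC => (hC.sep v hvC u hu).2 e.symm

/-- Double subdividing an edge with an end of degree two creates no thick cut. -/
theorem HasThickCut.of_doubleSubdivision {c : V} (h : G.EdgeRobust) (hs : G.DegreeTwoSplit)
    (hcb : c ≠ b) (hN : ∀ u, G.Adj a u ↔ u = b ∨ u = c)
    (hC : (G.doubleSubdivision a b).HasThickCut) : G.HasThickCut := by
  have hab : G.Adj a b := (hN b).2 (Or.inl rfl)
  have hac : G.Adj a c := (hN c).2 (Or.inr rfl)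
  have hrob := h.doubleSubdivision hab
  obtain ⟨hbc, E, hE⟩ := hs a b c hcb.symm hN
  have hadj : ∀ u v, G.Adj u v → ¬ (u = a ∧ v = b) → ¬ (u = b ∧ v = a) →
      (G.doubleSubdivision a b).Adj (.inl u) (.inl v) := by
    intro u v e h1 h2
    simp [e, h1, h2]
  -- a part of the split at `a` that avoids a given vertex
  have hpart : ∀ y, ∃ k, y ∉ E k := by
    intro y
    by_cases h0 : y ∈ E 0
    · exact ⟨1, fun h1 => by simpa using hE.sep 0 1 y h0 y h1 (Or.inl rfl)⟩
    · exact ⟨0, h0⟩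
  -- a thick cut does not separate `b` from `c` in the graph without `a`
  have hfar : ∀ x y C D, (G.doubleSubdivision a b).IsThickCut (.inl x) (.inl y) C D →
      (x = a ∨ x = b) → ∀ k, y ∉ E k → ∀ S : Set (V ⊕ Fin 2), (S = C ∨ S = D) →
      Sum.inl c ∈ S → ∀ d ∈ E k, Sum.inl d ∈ S := by
    intro x y C D hC hx k hy S hS hcS
    have hav := hE.avoid k
    have hxE : x ∉ E k := by rcases hx with rfl | rfl; exacts [hav.1, hav.2.1]
    have hclosed : ∀ u ∈ S, ∀ v, v ≠ .inl x → v ≠ .inl y →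
        (G.doubleSubdivision a b).Adj u v → v ∈ S := by
      intro u hu v h1 h2 e
      rcases hS with rfl | rfl
      · exact (hC.cover v h1 h2).resolve_right fun hv => (hC.sep u hu v hv).2 e
      · exact (hC.cover v h1 h2).resolve_left fun hv => (hC.sep v hv u hu).2 e.symm
    have hcl : ∀ u, Sum.inl u ∈ S → ∀ v ∈ E k, G.Adj u v → u ≠ b → Sum.inl v ∈ S := by
      intro u hu v hv e hub
      refine hclosed _ hu _ ?_ ?_ (hadj u v e ?_ ?_)
      · simp; rintro rfl; exact hxE hv
      · simp; rintro rfl; exact hy hv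
      · rintro ⟨rfl, rfl⟩; exact hav.2.1 hv
      · rintro ⟨rfl, rfl⟩; exact hav.1 hv
    obtain ⟨d, hd, hcd⟩ := hE.right k
    have := (hE.conn k).2 (E k ∩ Sum.inl ⁻¹' S) Set.inter_subset_left
      ⟨d, hd, hcl c hcS d hd hcd hcb⟩
      (fun u hu v hv e => ⟨hv, hcl u hu.2 v hv e (fun hub => hav.2.1 (hub ▸ hu.1))⟩)
    exact fun d hd => (this hd).2
  -- The vertex `a` lies in no thick cut. Its neighbours are now `c` and the new vertices, so `C`
  -- contains a new vertex. If `y = b`, that vertex is all of `C`. Otherwise `b` is in `C`,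
  -- robustness puts `c` in `D`, and a part of the split avoiding `y` joins them.
  have hxa : ∀ y C D, ¬ (G.doubleSubdivision a b).IsThickCut (.inl a) (.inl y) C D := by
    intro y C D hC
    by_cases hyb : y = b
    · subst hyb
      have : ∃ i, Sum.inr i ∈ C := by
        obtain ⟨u | k, hu, v | l, hv, huv, h1, h2⟩ := hC.left
        · simp [hN, hab.ne] at h1 h2
          grind
        all_goals exact ⟨_, by assumption⟩
      obtain ⟨i, hi⟩ := this
      obtain ⟨u, hu, v, hv, huv, -, -⟩ := hC.left
      have hav := hC.avoid_left.1
      have hbv := hC.avoid_right.1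
      have : ∀ u ∈ C, u = .inr i := by
        intro u hu
        by_contra hne
        obtain ⟨w | j, hw, e⟩ := hC.conn.exists_adj_of_mem hi hu hne
        · rcases doubleSubdivision_adj_inr_inl.1 e with rfl | rfl <;> contradiction
        · exact e.elim
      exact huv ((this u hu).trans (this v hv).symm)
    · have hinr : ∃ i, Sum.inr i ∈ C := by
        obtain ⟨u | k, hu, v | l, hv, huv, h1, h2⟩ := hC.left
        · simp [hN] at h1 h2
          grind
        all_goals exact ⟨_, by assumption⟩
      obtain ⟨i, hi⟩ := hinr
      have hbC : Sum.inl b ∈ C := by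
        refine (hC.cover _ (by simpa using hab.ne') (by simpa using Ne.symm hyb)).resolve_right
          fun hb => (hC.sep _ hi _ hb).2 (by simp)
      have hcD : Sum.inl c ∈ D := by
        by_contra hcD
        refine hC.avoid_left.2 ((hrob.vertex (.inl y)).2 D
          (fun d hd hdy => hC.avoid_right.2 (hdy ▸ hd)) hC.nonempty (fun u hu v hv e => ?_)
          (by simpa using hC.ne))
        by_cases hvx : v = .inl a
        · subst hvx
          rcases u with u | j
          · have e := (doubleSubdivision_adj_inl_inl.1 e)
            rcases (hN u).1 e.1.symm with rfl | rfl
            · exact (e.2 Sym2.eq_swap).elim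
            · exact (hcD hu).elim
          · exact ((hC.sep _ hbC _ hu).2 (by simp)).elim
        · exact (hC.cover v hvx hv).resolve_left fun hvC => (hC.sep v hvC u hu).2 e.symm
      obtain ⟨k, hk⟩ := hpart y
      obtain ⟨d, hd, hbd⟩ := hE.left k
      refine (hC.sep _ hbC _ (hfar a y C D hC (Or.inl rfl) k hk D (Or.inr rfl) hcD d hd)).2
        (hadj b d hbd (fun h => hab.ne' h.1) ?_)
      rintro ⟨-, rfl⟩; exact (hE.avoid k).1 hd
  -- two old neighbours of a vertex of the cut
  have htwo : ∀ x y C D, (G.doubleSubdivision a b).IsThickCut (.inl x) (.inl y) C D →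
      x ≠ a → y ≠ a → ∃ u ∈ Sum.inl ⁻¹' C, ∃ v ∈ Sum.inl ⁻¹' C, u ≠ v ∧ G.Adj x u ∧ G.Adj x v := by
    intro x y C D hC hx hy
    obtain ⟨u, hu, v, hv, huv, h1, h2⟩ := hC.left
    by_cases hinr : ∃ i, Sum.inr i ∈ C ∧ (G.doubleSubdivision a b).Adj (.inl x) (.inr i)
    · obtain ⟨i, hi, hxi⟩ := hinr
      obtain rfl : x = b := (doubleSubdivision_adj_inl_inr.1 hxi).resolve_left hx
      have haC : Sum.inl a ∈ C := by
        refine (hC.cover _ (by simpa using hx.symm) (by simpa using hy.symm)).resolve_right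
          fun hb => (hC.sep _ hi _ hb).2 (by simp)
      -- If `c = y`, then `C` consists of `a` and new vertices, leaving `y` only one neighbour
      -- there. Otherwise `c` and a part avoiding `y` lie in `C`, giving `b` the old neighbours `a`
      -- and `d`.
      by_cases hcy : c = y
      · subst hcy
        have hCa : ∀ z ∈ C, z = .inl a ∨ ∃ j, z = .inr j := by
          have := hC.conn.2 (C ∩ {z | z = .inl a ∨ ∃ j, z = .inr j}) Set.inter_subset_left
            ⟨_, haC, Or.inl rfl⟩ ?_
          · exact fun z hz => (this hz).2
          rintro u ⟨hu, hu'⟩ (v | j) hv e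
          · refine ⟨hv, Or.inl ?_⟩
            rcases hu' with rfl | ⟨j, rfl⟩
            · rcases (hN v).1 (doubleSubdivision_adj_inl_inl.1 e).1 with rfl | rfl
              · exact (hC.avoid_left.1 hv).elim
              · exact (hC.avoid_right.1 hv).elim
            · rcases doubleSubdivision_adj_inr_inl.1 e with rfl | rfl
              · rfl
              · exact (hC.avoid_left.1 hv).elim
          · exact ⟨hv, Or.inr ⟨j, rfl⟩⟩
        have hca : ∀ z ∈ C, (G.doubleSubdivision a x).Adj (.inl c) z → z = .inl a := by
          intro z hz e
          rcases hCa z hz with rfl | ⟨j, rfl⟩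
          · rfl
          · exact absurd e (by simp [hac.ne', hcb])
        obtain ⟨u, hu, v, hv, huv, h1, h2⟩ := hC.right
        exact (huv ((hca u hu h1).trans (hca v hv h2).symm)).elim
      · have hcC : Sum.inl c ∈ C :=
          (hC.cover _ (by simpa using hcb) (by simpa using hcy)).resolve_right
            fun hc => (hC.sep _ haC _ hc).2 (hadj a c hac (fun h => hcb h.2) (fun h => hx h.1.symm))
        obtain ⟨k, hk⟩ := hpart y
        obtain ⟨d, hd, hbd⟩ := hE.left k
        refine ⟨a, haC, d, hfar _ y C D hC (Or.inr rfl) k hk C (Or.inl rfl) hcC d hd, ?_,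
          hab.symm, hbd⟩
        rintro rfl; exact (hE.avoid k).1 hd
    · rcases u with u | i
      swap
      · exact (hinr ⟨i, hu, h1⟩).elim
      rcases v with v | i
      swap
      · exact (hinr ⟨i, hv, h2⟩).elim
      exact ⟨u, hu, v, hv, by simpa using huv, (doubleSubdivision_adj_inl_inl.1 h1).1,
        (doubleSubdivision_adj_inl_inl.1 h2).1⟩
  obtain ⟨x | i, y | j, C, D, hC⟩ := hC
  · have hx : x ≠ a := by rintro rfl; exact hxa _ _ _ hC
    have hy : y ≠ a := by rintro rfl; exact hxa _ _ _ hC.symm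
    have haCD := hC.cover (.inl a) (by simpa using hx.symm) (by simpa using hy.symm)
    obtain ⟨u, hu, v, hv, huv, h1, h2⟩ := htwo x y C D hC hx hy
    refine ⟨x, y, Sum.inl ⁻¹' C, Sum.inl ⁻¹' D, by simpa using hC.ne,
      hC.conn.of_doubleSubdivision hab ⟨u, hu⟩, ?_, ?_, hC.avoid_left, hC.avoid_right, ?_,
      ⟨u, hu, v, hv, huv, h1, h2⟩, htwo y x C D hC.symm hy hx⟩
    · obtain ⟨d | i, hd⟩ := hC.nonempty
      · exact ⟨d, hd⟩
      · exact ⟨a, haCD.resolve_left fun ha => (hC.sep _ ha _ hd).2 (by simp)⟩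
    · exact fun v h1 h2 => hC.cover (.inl v) (by simpa using h1) (by simpa using h2)
    · intro u hu v hv
      have hsep := hC.sep _ hu _ hv
      refine ⟨by simpa using hsep.1, fun e => ?_⟩
      have h0 := hC.cover (.inr 0) (by simp) (by simp)
      by_cases hs : s(u, v) = s(a, b)
      · rcases h0 with h0 | h0
        · refine (hC.sep _ h0 _ hv).2 ?_
          rcases Sym2.eq_iff.1 hs with ⟨rfl, rfl⟩ | ⟨rfl, rfl⟩ <;> simp
        · refine (hC.sep _ hu _ h0).2 ?_
          rcases Sym2.eq_iff.1 hs with ⟨rfl, rfl⟩ | ⟨rfl, rfl⟩ <;> simp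
      · exact hsep.2 (doubleSubdivision_adj_inl_inl.2 ⟨e, hs⟩)
  · exact (hC.symm.false_of_left_inr hrob).elim
  · exact (hC.false_of_left_inr hrob).elim
  · exact (hC.false_of_left_inr hrob).elim

end DoubleSubdivision

/-! ### Minors H₀ when an end of the subdivided edge has degree two -/

instance : DecidableRel H0.Adj := by unfold H0; infer_instance

theorem H0_exists_two_adj : ∀ w, ∃ u v, u ≠ v ∧ H0.Adj w u ∧ H0.Adj w v := by decide

-- Such a `w` is a subdivision vertex, and `h`, `h'` are the ends of the triangle edge it replaced.
set_option synthInstance.maxHeartbeats 200000 in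
set_option synthInstance.maxSize 2000 in
set_option maxRecDepth 10000 in
theorem H0_of_adj_subset_pair : ∀ h h' w, (∀ u, H0.Adj w u → u = h ∨ u = h') →
    ¬ H0.Adj h h' ∧ w ≠ h ∧ w ≠ h' := by
  decide

-- The vertex `g` is the third vertex of the triangle, adjacent to all four remaining subdivision
-- vertices.
set_option synthInstance.maxHeartbeats 200000 in
set_option synthInstance.maxSize 2000 in
set_option maxRecDepth 10000 in
theorem H0_exists_center : ∀ h h' w₀, (∀ u, H0.Adj w₀ u → u = h ∨ u = h') →
    ∀ w₁, (∀ u, H0.Adj w₁ u → u = h ∨ u = h') → w₁ = w₀ ∨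
      ∃ g, ¬ (g = h ∨ g = h' ∨ g = w₀ ∨ g = w₁) ∧
        ∀ w, w = h ∨ w = h' ∨ w = w₀ ∨ w = w₁ ∨ w = g ∨ H0.Adj w g := by
  decide

-- The vertices `x` and `y` are the two subdivision vertices between `h` and the third vertex of the
-- triangle.
set_option synthInstance.maxHeartbeats 200000 in
set_option synthInstance.maxSize 2000 in
set_option maxRecDepth 10000 in
theorem H0_exists_other_adj : ∀ h h' w, (∀ u, H0.Adj w u → u = h ∨ u = h') →
    ∃ x y, x ≠ y ∧ ∀ z, z = x ∨ z = y → H0.Adj h z ∧ z ≠ h' ∧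
      ¬ (∀ u, H0.Adj z u → u = h ∨ u = h') := by
  decide

section DoubleSubdivision

variable {G : SimpleGraph V} {a b c : V} {H : SimpleGraph W}

/-- A branch set at an end `a` of degree two of the subdivided edge cannot consist of `a` and new
vertices only, unless it has few neighbours. -/
theorem IsModel.inl_mem_of_two_adj {B : W → Set (V ⊕ Fin 2)}
    (hB : H.IsModel (G.doubleSubdivision a b) B) (hN : ∀ u, G.Adj a u ↔ u = b ∨ u = c)
    {h h' x y : W} (ha : Sum.inl a ∈ B h) (hb : Sum.inl b ∈ B h') (hh : h ≠ h') (hxy : x ≠ y)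
    (hz : ∀ z, z = x ∨ z = y → H.Adj h z ∧ z ≠ h' ∧ ∃ v, Sum.inl v ∈ B z) :
    Sum.inl c ∈ B h := by
  by_contra hc
  have hbh : Sum.inl b ∉ B h := fun hb' => hh (hB.eq_of_mem _ _ _ hb' hb)
  -- Without `c`, the set `B h` is confined to `a` and new vertices. Its only way to the branch sets
  -- of `x` and `y` is then through `c`, which cannot lie in both.
  have hBh : ∀ z ∈ B h, z = .inl a ∨ ∃ j, z = .inr j := by
    have := (hB.conn h).2 (B h ∩ {z | z = .inl a ∨ ∃ j, z = .inr j}) Set.inter_subset_left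
      ⟨_, ha, Or.inl rfl⟩ ?_
    · exact fun z hz => (this hz).2
    rintro u ⟨hu, hu'⟩ (v | j) hv e
    · refine ⟨hv, Or.inl ?_⟩
      rcases hu' with rfl | ⟨j, rfl⟩
      · rcases (hN v).1 (doubleSubdivision_adj_inl_inl.1 e).1 with rfl | rfl <;> contradiction
      · rcases doubleSubdivision_adj_inr_inl.1 e with rfl | rfl
        · rfl
        · contradiction
    · exact ⟨hv, Or.inr ⟨j, rfl⟩⟩
  have key : ∀ z, z = x ∨ z = y → Sum.inl c ∈ B z := by
    intro z hz'
    obtain ⟨hhz, hzh', v, hv⟩ := hz z hz'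
    have haz : Sum.inl a ∉ B z := fun ha' => hhz.ne (hB.eq_of_mem _ _ _ ha ha')
    have hbz : Sum.inl b ∉ B z := fun hb' => hzh' (hB.eq_of_mem _ _ _ hb' hb)
    obtain ⟨p, hp, q | j, hq, e⟩ := hB.adj h z hhz
    · rcases hBh p hp with rfl | ⟨j, rfl⟩
      · rcases (hN q).1 (doubleSubdivision_adj_inl_inl.1 e).1 with rfl | rfl
        · contradiction
        · exact hq
      · rcases doubleSubdivision_adj_inr_inl.1 e with rfl | rfl <;> contradiction
    · rcases (hB.conn z).mem_or_mem_of_inr_mem hq (fun h => by simp [h] at hv) with h | h <;>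
        contradiction
  exact hxy (hB.eq_of_mem _ _ _ (key x (Or.inl rfl)) (key y (Or.inr rfl)))

/-- If a new vertex alone is a branch set, then its role can be taken over by the end `a` of
degree two of the subdivided edge. -/
theorem IsModel.of_inr_branchSet {B : W → Set (V ⊕ Fin 2)}
    (hB : H.IsModel (G.doubleSubdivision a b) B) (hcb : c ≠ b)
    (hN : ∀ u, G.Adj a u ↔ u = b ∨ u = c) {w₀ h h' : W} {i : Fin 2} (hw₀ : B w₀ = {Sum.inr i})
    (hw : ∀ u, H.Adj w₀ u → u = h ∨ u = h') (hadj : ¬ H.Adj h h') (ha : Sum.inl a ∈ B h)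
    (hc : Sum.inl c ∈ B h) (hb : Sum.inl b ∈ B h') (hh : h ≠ h')
    (hne : ∀ w, w ≠ w₀ → ∃ v, Sum.inl v ∈ B w) : H.IsMinor G := by
  classical
  have hab : G.Adj a b := (hN b).2 (Or.inl rfl)
  have hac : G.Adj a c := (hN c).2 (Or.inr rfl)
  have haw : ∀ w, Sum.inl a ∈ B w → w = h := fun w h' => hB.eq_of_mem _ _ _ h' ha
  have hbw : ∀ w, Sum.inl b ∈ B w → w = h' := fun w h => hB.eq_of_mem _ _ _ h hb
  have hw₀h : w₀ ≠ h := by rintro rfl; simp [hw₀] at ha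
  have hw₀h' : w₀ ≠ h' := by rintro rfl; simp [hw₀] at hb
  -- The vertex `a` moves from `B h` to become the branch set of `w₀`: its neighbours `c` and `b`
  -- lie in the sets of `h` and `h'`. The rest of `B h` stays connected because `a` was attached to
  -- it only at `c`.
  let B' : W → Set V := fun w => if w = w₀ then {a} else (Sum.inl ⁻¹' B w) \ {a}
  have hB'₀ : B' w₀ = {a} := if_pos rfl
  have hB' : ∀ w, w ≠ w₀ → B' w = (Sum.inl ⁻¹' B w) \ {a} := fun w hw => if_neg hw
  have hadj₀ : ∀ w, H.Adj w₀ w → ∃ p ∈ B' w₀, ∃ q ∈ B' w, G.Adj p q := by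
    intro w e
    rw [hB'₀, hB' w e.ne']
    rcases hw w e with rfl | rfl
    · exact ⟨a, rfl, c, ⟨hc, hac.ne'⟩, hac⟩
    · exact ⟨a, rfl, b, ⟨hb, hab.ne'⟩, hab⟩
  -- Any other branch set with a new vertex belongs to `h` or `h'`; contact through that vertex
  -- would join `h` to `h'`, which are nonadjacent in `H`.
  have hinr : ∀ w w' j v, H.Adj w w' → w ≠ w₀ → Sum.inr j ∈ B w → v = a ∨ v = b →
      Sum.inl v ∉ B w' := by
    intro w w' j v e hww₀ hj hv hv'
    obtain ⟨x, hx⟩ := hne w hww₀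
    have h1 : w = h ∨ w = h' :=
      ((hB.conn w).mem_or_mem_of_inr_mem hj (fun h => by simp [h] at hx)).imp (haw w) (hbw w)
    have h2 : w' = h ∨ w' = h' := by
      rcases hv with rfl | rfl
      exacts [Or.inl (haw _ hv'), Or.inr (hbw _ hv')]
    rcases h1 with rfl | rfl <;> rcases h2 with rfl | rfl
    exacts [e.ne rfl, hadj e, hadj e.symm, e.ne rfl]
  have hap : ∀ w w' v, H.Adj w w' → Sum.inl a ∈ B w → Sum.inl v ∈ B w' →
      ¬ (G.doubleSubdivision a b).Adj (.inl a) (.inl v) := by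
    intro w w' v e h1 h2 h3
    obtain ⟨h3, h4⟩ := doubleSubdivision_adj_inl_inl.1 h3
    rcases (hN v).1 h3 with rfl | rfl
    · exact h4 rfl
    · exact e.ne ((haw w h1).trans (hB.eq_of_mem _ _ _ hc h2))
  refine isMinor_iff_exists_isModel.2 ⟨B', ?_, ?_, ?_⟩
  · intro w
    by_cases hww₀ : w = w₀
    · rw [hww₀, hB'₀]; exact isConn_singleton _ _
    · have hconn := (hB.conn w).of_doubleSubdivision hab (hne w hww₀)
      rw [hB' w hww₀]
      by_cases hwh : w = h
      · subst hwh
        refine hconn.diff (z := c) hc hac.ne' ?_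
        rintro u hu _ huc r _ rfl e
        rcases (hN u).1 e.symm with rfl | rfl
        · exact hh (hbw _ hu)
        · exact huc rfl
      · rwa [Set.sdiff_singleton_eq_self]
        exact fun h => hwh (haw w h)
  · intro w w' x hx hx'
    by_cases h1 : w = w₀ <;> by_cases h2 : w' = w₀
    · rw [h1, h2]
    · rw [h1, hB'₀] at hx
      rw [hB' w' h2] at hx'
      exact (hx'.2 hx).elim
    · rw [h2, hB'₀] at hx'
      rw [hB' w h1] at hx
      exact (hx.2 hx').elim
    · rw [hB' w h1] at hx
      rw [hB' w' h2] at hx'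
      exact hB.eq_of_mem _ _ _ hx.1 hx'.1
  · intro w w' e
    by_cases h1 : w = w₀
    · subst h1; exact hadj₀ w' e
    by_cases h2 : w' = w₀
    · subst h2
      obtain ⟨p, hp, q, hq, hpq⟩ := hadj₀ w e.symm
      exact ⟨q, hq, p, hp, hpq.symm⟩
    rw [hB' w h1, hB' w' h2]
    obtain ⟨p | j, hp, q | k, hq, hpq⟩ := hB.adj w w' e
    · refine ⟨p, ⟨hp, ?_⟩, q, ⟨hq, ?_⟩, (doubleSubdivision_adj_inl_inl.1 hpq).1⟩
      · rintro rfl; exact hap _ _ _ e hp hq hpq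
      · rintro rfl; exact hap _ _ _ e.symm hq hp hpq.symm
    · exact (hinr w' w k p e.symm h2 hq (doubleSubdivision_adj_inl_inr.1 hpq) hp).elim
    · exact (hinr w w' j q e h1 hp (doubleSubdivision_adj_inr_inl.1 hpq) hq).elim
    · exact hpq.elim

/-- If both new vertices are branch sets, then the role of one of them can be taken over by a
part of the split at the end `a` of degree two. -/
theorem IsModel.reroute {B : W → Set (V ⊕ Fin 2)}
    (hB : H.IsModel (G.doubleSubdivision a b) B)
    (hN : ∀ u, G.Adj a u ↔ u = b ∨ u = c) {E : Fin 2 → Set V} (hE : G.IsSplit a b c E)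
    {w₁ h h' : W} {k : Fin 2}
    (hw : ∀ u, H.Adj w₁ u → u = h ∨ u = h') (hadj : ¬ H.Adj h h')
    (hwh : w₁ ≠ h) (hwh' : w₁ ≠ h')
    (hc : Sum.inl c ∈ B h) (hb : Sum.inl b ∈ B h') (hh : h ≠ h')
    (hdisj : ∀ w, w ≠ h → w ≠ h' → w ≠ w₁ → ∀ v ∈ E k, Sum.inl v ∉ B w) :
    ∃ B', H.IsModel (G.doubleSubdivision a b) B' ∧ B' w₁ = Sum.inl '' E k ∧
      ∀ w, w ≠ w₁ → B' w = B w \ Sum.inl '' E k := by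
  classical
  have hab : G.Adj a b := (hN b).2 (Or.inl rfl)
  obtain ⟨hEa, hEb, hEc⟩ := hE.avoid k
  have hcw : ∀ w, Sum.inl c ∈ B w → w = h := fun w h' => hB.eq_of_mem _ _ _ h' hc
  have hbw : ∀ w, Sum.inl b ∈ B w → w = h' := fun w h => hB.eq_of_mem _ _ _ h hb
  -- The part `E k` meets the outside only at `b` and `c`, so cutting it out of `B h` and `B h'`
  -- leaves them connected.
  have hnbr : ∀ u r, r ∈ E k → (G.doubleSubdivision a b).Adj u (.inl r) →
      u = .inl b ∨ u = .inl c ∨ u ∈ (Sum.inl '' E k : Set (V ⊕ Fin 2)) := by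
    rintro (u | j) r hr e
    · replace e := (doubleSubdivision_adj_inl_inl.1 e).1
      by_cases hua : u = a
      · subst hua
        rcases (hN r).1 e with rfl | rfl <;> contradiction
      by_cases hub : u = b
      · exact Or.inl (hub ▸ rfl)
      by_cases huc : u = c
      · exact Or.inr (Or.inl (huc ▸ rfl))
      obtain ⟨l, hl⟩ := hE.cover u hua hub huc
      obtain rfl := hE.sep l k u hl r hr (Or.inr e)
      exact Or.inr (Or.inr ⟨u, hl, rfl⟩)
    · rcases doubleSubdivision_adj_inr_inl.1 e with rfl | rfl <;> contradiction
  let B' : W → Set (V ⊕ Fin 2) := fun w => if w = w₁ then Sum.inl '' E k else B w \ Sum.inl '' E k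
  have hB'₁ : B' w₁ = Sum.inl '' E k := if_pos rfl
  have hB' : ∀ w, w ≠ w₁ → B' w = B w \ Sum.inl '' E k := fun w hw => if_neg hw
  have hadj₁ : ∀ w, H.Adj w₁ w → ∃ p ∈ B' w₁, ∃ q ∈ B' w, (G.doubleSubdivision a b).Adj p q := by
    intro w e
    rw [hB'₁, hB' w e.ne']
    have hba : ∀ u d, d ∈ E k → G.Adj u d → u ≠ a →
        (G.doubleSubdivision a b).Adj (.inl d) (.inl u) := by
      intro u d hd e hu
      refine doubleSubdivision_adj_inl_inl.2 ⟨e.symm, fun hs => ?_⟩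
      rcases Sym2.eq_iff.1 hs with ⟨rfl, rfl⟩ | ⟨rfl, rfl⟩ <;> contradiction
    rcases hw w e with rfl | rfl
    · obtain ⟨d, hd, e⟩ := hE.right k
      exact ⟨.inl d, ⟨d, hd, rfl⟩, .inl c, ⟨hc, by simpa using hEc⟩,
        hba c d hd e ((hN c).2 (Or.inr rfl)).ne'⟩
    · obtain ⟨d, hd, e⟩ := hE.left k
      exact ⟨.inl d, ⟨d, hd, rfl⟩, .inl b, ⟨hb, by simpa using hEb⟩, hba b d hd e hab.ne'⟩
  have hnot : ∀ w w' p q, H.Adj w w' → w ≠ w₁ → w' ≠ w₁ → p ∈ B w → q ∈ B w' →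
      (G.doubleSubdivision a b).Adj p q → p ∉ (Sum.inl '' E k : Set (V ⊕ Fin 2)) := by
    rintro w w' _ q e h1 h2 hp hq hpq ⟨p, hpE, rfl⟩
    have hmem : ∀ w v, w ≠ w₁ → v ∈ E k → Sum.inl v ∈ B w → w = h ∨ w = h' := by
      intro w v h1 hv hvw
      by_contra! hcon
      exact hdisj w hcon.1 hcon.2 h1 v hv hvw
    have hw := hmem w p h1 hpE hp
    have hw' : w' = h ∨ w' = h' := by
      rcases hnbr q p hpE hpq.symm with rfl | rfl | ⟨q, hqE, rfl⟩
      · exact Or.inr (hbw _ hq)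
      · exact Or.inl (hcw _ hq)
      · exact hmem w' q h2 hqE hq
    rcases hw with rfl | rfl <;> rcases hw' with rfl | rfl
    exacts [e.ne rfl, hadj e, hadj e.symm, e.ne rfl]
  refine ⟨B', ⟨?_, ?_, ?_⟩, hB'₁, hB'⟩
  · intro w
    by_cases hww : w = w₁
    · rw [hww, hB'₁]
      refine IsConn.doubleSubdivision ?_ (by simp) (by simp [hEa])
      convert hE.conn k using 1
      ext; simp
    rw [hB' w hww]
    by_cases h1 : w = h
    · subst h1
      refine (hB.conn w).diff hc (by simpa using hEc) ?_
      rintro u hu huE huc _ _ ⟨r, hr, rfl⟩ e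
      rcases hnbr u r hr e with rfl | rfl | h
      exacts [hh (hbw _ hu), huc rfl, huE h]
    by_cases h2 : w = h'
    · subst h2
      refine (hB.conn w).diff hb (by simpa using hEb) ?_
      rintro u hu huE hub _ _ ⟨r, hr, rfl⟩ e
      rcases hnbr u r hr e with rfl | rfl | h
      exacts [hub rfl, hh (hcw _ hu).symm, huE h]
    rw [sdiff_eq_left.2]
    · exact hB.conn w
    · rw [Set.disjoint_left]
      rintro _ hu ⟨v, hv, rfl⟩
      exact hdisj w h1 h2 hww v hv hu
  · intro w w' x hx hx'
    by_cases h1 : w = w₁ <;> by_cases h2 : w' = w₁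
    · rw [h1, h2]
    · rw [h1, hB'₁] at hx
      rw [hB' w' h2] at hx'
      exact (hx'.2 hx).elim
    · rw [h2, hB'₁] at hx'
      rw [hB' w h1] at hx
      exact (hx.2 hx').elim
    · rw [hB' w h1] at hx
      rw [hB' w' h2] at hx'
      exact hB.eq_of_mem _ _ _ hx.1 hx'.1
  · intro w w' e
    by_cases h1 : w = w₁
    · subst h1; exact hadj₁ w' e
    by_cases h2 : w' = w₁
    · subst h2
      obtain ⟨p, hp, q, hq, hpq⟩ := hadj₁ w e.symm
      exact ⟨q, hq, p, hp, hpq.symm⟩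
    rw [hB' w h1, hB' w' h2]
    obtain ⟨p, hp, q, hq, hpq⟩ := hB.adj w w' e
    exact ⟨p, ⟨hp, hnot w w' p q e h1 h2 hp hq hpq⟩, q,
      ⟨hq, hnot w' w q p e.symm h2 h1 hq hp hpq.symm⟩, hpq⟩

/-- Double subdividing an edge with an end of degree two creates no `H₀`-minor. -/
theorem H0_isMinor_of_doubleSubdivision (hcb : c ≠ b) (hN : ∀ u, G.Adj a u ↔ u = b ∨ u = c)
    {E : Fin 2 → Set V} (hE : G.IsSplit a b c E)
    (hG : H0.IsMinor (G.doubleSubdivision a b)) : H0.IsMinor G := by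
  have hab : G.Adj a b := (hN b).2 (Or.inl rfl)
  obtain ⟨B, hB⟩ := isMinor_iff_exists_isModel.1 hG
  have hsing : ∀ w, (∃ v, Sum.inl v ∈ B w) ∨ ∃ i, B w = {Sum.inr i} := by
    intro w
    by_cases h : ∃ v, Sum.inl v ∈ B w
    · exact Or.inl h
    push Not at h
    obtain ⟨v | i, hv⟩ := (hB.conn w).1
    · exact (h v hv).elim
    refine Or.inr ⟨i, ?_⟩
    by_contra hne
    rcases (hB.conn w).mem_or_mem_of_inr_mem hv hne with h' | h' <;> exact h _ h'
  by_cases hall : ∀ w, ∃ v, Sum.inl v ∈ B w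
  · exact isMinor_iff_exists_isModel.2 ⟨_, hB.of_doubleSubdivision hab hall⟩
  push Not at hall
  obtain ⟨w₀, hw₀⟩ := hall
  obtain ⟨i, hi⟩ := (hsing w₀).resolve_left fun ⟨v, hv⟩ => hw₀ v hv
  have hends : ∀ w j, B w = {Sum.inr j} → ∀ u, H0.Adj w u → Sum.inl a ∈ B u ∨ Sum.inl b ∈ B u := by
    intro w j hw u e
    obtain ⟨p, hp, q | l, hq, hpq⟩ := hB.adj w u e
    · rw [hw] at hp
      obtain rfl := hp
      rcases doubleSubdivision_adj_inr_inl.1 hpq with rfl | rfl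
      exacts [Or.inl hq, Or.inr hq]
    · rw [hw] at hp
      obtain rfl := hp
      exact hpq.elim
  obtain ⟨h, h', ha, hb⟩ : ∃ h h', Sum.inl a ∈ B h ∧ Sum.inl b ∈ B h' ∧ h ≠ h' := by
    obtain ⟨u, v, huv, hu, hv⟩ := H0_exists_two_adj w₀
    rcases hends w₀ i hi u hu with h1 | h1 <;> rcases hends w₀ i hi v hv with h2 | h2
    · exact (huv (hB.eq_of_mem _ _ _ h1 h2)).elim
    · exact ⟨u, v, h1, h2, huv⟩
    · exact ⟨v, u, h2, h1, huv.symm⟩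
    · exact (huv (hB.eq_of_mem _ _ _ h1 h2)).elim
  obtain ⟨hb, hh⟩ := hb
  have hpair : ∀ w j, B w = {Sum.inr j} → ∀ u, H0.Adj w u → u = h ∨ u = h' :=
    fun w j hw u e => (hends w j hw u e).imp (fun hu => hB.eq_of_mem _ _ _ hu ha)
      (fun hu => hB.eq_of_mem _ _ _ hu hb)
  obtain ⟨hadj, hw₀h, hw₀h'⟩ := H0_of_adj_subset_pair h h' w₀ (hpair w₀ i hi)
  obtain ⟨x, y, hxy, hz⟩ := H0_exists_other_adj h h' w₀ (hpair w₀ i hi)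
  have hc : Sum.inl c ∈ B h := hB.inl_mem_of_two_adj hN ha hb hh hxy fun z hz' =>
    ⟨(hz z hz').1, (hz z hz').2.1,
      (hsing z).resolve_right fun ⟨j, hj⟩ => (hz z hz').2.2 (hpair z j hj)⟩
  by_cases hone : ∀ w, w ≠ w₀ → ∃ v, Sum.inl v ∈ B w
  · exact hB.of_inr_branchSet hcb hN hi (hpair w₀ i hi) hadj ha hc hb hh hone
  push Not at hone
  obtain ⟨w₁, hw₁₀, hw₁⟩ := hone
  obtain ⟨j, hj⟩ := (hsing w₁).resolve_left fun ⟨v, hv⟩ => hw₁ v hv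
  have hij : j ≠ i := by
    rintro rfl
    exact hw₁₀ (hB.eq_of_mem w₁ w₀ (.inr j) (by simp [hj]) (by simp [hi]))
  obtain ⟨-, hw₁h, hw₁h'⟩ := H0_of_adj_subset_pair h h' w₁ (hpair w₁ j hj)
  have hinr : ∀ w, w ≠ w₀ → w ≠ w₁ → ∀ k, Sum.inr k ∉ B w := by
    intro w h0 h1 k hk
    by_cases hki : k = i
    · exact h0 (hB.eq_of_mem _ _ _ hk (by simp [hi, hki]))
    · exact h1 (hB.eq_of_mem _ _ _ hk (by simp [hj]; lia))
  have hinl : ∀ w, w ≠ w₀ → w ≠ w₁ → ∃ v, Sum.inl v ∈ B w := fun w h0 h1 =>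
    (hsing w).resolve_right fun ⟨k, hk⟩ => hinr w h0 h1 k (by simp [hk])
  -- every other branch set lies in one part of the split
  have hpart : ∀ w, w ≠ h → w ≠ h' → w ≠ w₀ → w ≠ w₁ →
      ∃ k, ∀ v, Sum.inl v ∈ B w → v ∈ E k := by
    intro w h1 h2 h3 h4
    have hwa : Sum.inl a ∉ B w := fun h => h1 (hB.eq_of_mem _ _ _ h ha)
    have hwb : Sum.inl b ∉ B w := fun h => h2 (hB.eq_of_mem _ _ _ h hb)
    have hwc : Sum.inl c ∉ B w := fun h => h1 (hB.eq_of_mem _ _ _ h hc)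
    have hcov : ∀ v, Sum.inl v ∈ B w → ∃ k, v ∈ E k := fun v hv =>
      hE.cover v (by rintro rfl; exact hwa hv) (by rintro rfl; exact hwb hv)
        (by rintro rfl; exact hwc hv)
    have hconn := (hB.conn w).of_doubleSubdivision hab (hinl w h3 h4)
    obtain ⟨v, hv⟩ := hinl w h3 h4
    obtain ⟨k, hk⟩ := hcov v hv
    have := hconn.2 (Sum.inl ⁻¹' B w ∩ E k) Set.inter_subset_left ⟨v, hv, hk⟩ ?_
    · exact ⟨k, fun v hv => (this hv).2⟩
    rintro u ⟨hu, huk⟩ z hz e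
    obtain ⟨l, hl⟩ := hcov z hz
    obtain rfl := hE.sep k l u huk z hl (Or.inr e)
    exact ⟨hz, hl⟩
  -- Every remaining branch set touches that of the centre `g`, so all lie in the same part of the
  -- split and the other part is free.
  have hE2 : ∃ k, ∀ w, w ≠ h → w ≠ h' → w ≠ w₁ → ∀ v ∈ E k, Sum.inl v ∉ B w := by
    obtain ⟨g, hg, hgw⟩ :=
      (H0_exists_center h h' w₀ (hpair w₀ i hi) w₁ (hpair w₁ j hj)).resolve_left hw₁₀
    push Not at hg
    obtain ⟨l, hl⟩ := hpart g hg.1 hg.2.1 hg.2.2.1 hg.2.2.2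
    have hlw : ∀ w, w ≠ h → w ≠ h' → w ≠ w₁ → ∀ v, Sum.inl v ∈ B w → v ∈ E l := by
      intro w h1 h2 h3 v hv
      have h4 : w ≠ w₀ := by rintro rfl; exact hw₀ v hv
      rcases hgw w with hw | hw | hw | hw | rfl | e
      · contradiction
      · contradiction
      · contradiction
      · contradiction
      · exact hl v hv
      obtain ⟨m, hm⟩ := hpart w h1 h2 h4 h3
      obtain ⟨p | r, hp, q | r', hq, hpq⟩ := hB.adj w g e
      · obtain rfl := hE.sep m l p (hm p hp) q (hl q hq)
          (Or.inr (doubleSubdivision_adj_inl_inl.1 hpq).1)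
        exact hm v hv
      · exact (hinr g hg.2.2.1 hg.2.2.2 _ hq).elim
      · exact (hinr w h4 h3 _ hp).elim
      · exact hpq.elim
    refine ⟨l + 1, fun w h1 h2 h3 v hv hvw => ?_⟩
    have := hE.sep l (l + 1) v (hlw w h1 h2 h3 v hvw) v hv (Or.inl rfl)
    simp at this
  obtain ⟨k, hk⟩ := hE2
  obtain ⟨B', hB', hB'₁, hB'w⟩ := hB.reroute hN hE (hpair w₁ j hj) hadj hw₁h hw₁h' hc hb hh hk
  obtain ⟨hEa, hEb, hEc⟩ := hE.avoid k
  refine hB'.of_inr_branchSet (i := i) hcb hN ?_ (hpair w₀ i hi) hadj ?_ ?_ ?_ hh ?_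
  · rw [hB'w _ hw₁₀.symm, hi]
    exact sdiff_eq_left.2 (by simp)
  · rw [hB'w _ hw₁h.symm]; exact ⟨ha, by simpa using hEa⟩
  · rw [hB'w _ hw₁h.symm]; exact ⟨hc, by simpa using hEc⟩
  · rw [hB'w _ hw₁h'.symm]; exact ⟨hb, by simpa using hEb⟩
  · intro w hww₀
    by_cases hww₁ : w = w₁
    · obtain ⟨v, hv⟩ := (hE.conn k).1
      exact ⟨v, by rw [hww₁, hB'₁]; exact ⟨v, hv, rfl⟩⟩
    rw [hB'w w hww₁]
    by_cases h1 : w = h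
    · exact ⟨c, h1 ▸ hc, by simpa using hEc⟩
    by_cases h2 : w = h'
    · exact ⟨b, h2 ▸ hb, by simpa using hEb⟩
    obtain ⟨v, hv⟩ := hinl w hww₀ hww₁
    exact ⟨v, hv, by simpa using fun hvE => hk w h1 h2 hww₁ v hvE hv⟩

end DoubleSubdivision

/-! ### The induction over double subdivisions -/

/-- The properties of generalised triangles other than `K₃` that are preserved by double
subdivision of edges. -/
structure TriangleInvariant (G : SimpleGraph V) : Prop where
  robust : G.EdgeRobust
  split : G.DegreeTwoSplit
  rooted : G.ThickEdgesRooted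
  thickCut_iff : G.HasThickCut ↔ H0.IsMinor G

theorem TriangleInvariant.doubleSubdivision {G : SimpleGraph V} {a b : V}
    (h : G.TriangleInvariant) (hab : G.Adj a b) :
    (G.doubleSubdivision a b).TriangleInvariant := by
  refine ⟨h.robust.doubleSubdivision hab, h.split.doubleSubdivision h.robust hab,
    h.rooted.doubleSubdivision h.split h.robust hab, ?_⟩
  have hthin : ∀ {a b c : V}, c ≠ b → (∀ u, G.Adj a u ↔ u = b ∨ u = c) →
      ((G.doubleSubdivision a b).HasThickCut ↔ H0.IsMinor (G.doubleSubdivision a b)) := by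
    intro a b c hcb hN
    have hab : G.Adj a b := (hN b).2 (Or.inl rfl)
    obtain ⟨-, E, hE⟩ := h.split a b c hcb.symm hN
    constructor
    · intro hC
      obtain ⟨B, hB⟩ := isMinor_iff_exists_isModel.1
        (h.thickCut_iff.1 (hC.of_doubleSubdivision h.robust h.split hcb hN))
      obtain ⟨B', hB', -⟩ := hB.exists_lift a b
      exact isMinor_iff_exists_isModel.2 ⟨B', hB'⟩
    · exact fun hm => (h.thickCut_iff.2 (H0_isMinor_of_doubleSubdivision hcb hN hE hm)
        ).doubleSubdivision hab
  rcases h.robust.thick_or hab with ha | ⟨c, hc, hN⟩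
  · rcases h.robust.thick_or hab.symm with hb | ⟨c, hc, hN⟩
    · exact iff_of_true (Thick.hasThickCut h.robust hab ha hb)
        (h.rooted a b hab ha hb).h0_isMinor
    · rw [doubleSubdivision_comm]
      exact hthin hc hN
  · exact hthin hc hN

theorem isConn_top {S : Set V} (hS : S.Nonempty) : (⊤ : SimpleGraph V).IsConn S := by
  refine ⟨hS, fun T _ ⟨t, ht⟩ hT s hs => ?_⟩
  by_cases h : t = s
  · exact h ▸ ht
  · exact hT t ht s hs h

theorem edgeRobust_top_fin_three : (⊤ : SimpleGraph (Fin 3)).EdgeRobust := by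
  refine ⟨isConn_top ⟨0, trivial⟩, fun v => isConn_top ?_, fun u v _ => isConn_top ?_⟩
  · have : ∀ v : Fin 3, ∃ w, w ≠ v := by decide
    exact this v
  · have : ∀ u v : Fin 3, ∃ w, ¬ (w = u ∨ w = v) := by decide
    exact this u v

theorem not_hasThickCut_top_fin_three : ¬ (⊤ : SimpleGraph (Fin 3)).HasThickCut := by
  rintro ⟨x, y, C, D, h⟩
  obtain ⟨d, hd⟩ := h.nonempty
  obtain ⟨c, hc, c', hc', hcc, -, -⟩ := h.left
  have h1 := (h.sep c hc d hd).1
  have h2 : x ≠ c := fun e => h.avoid_left.1 (e ▸ hc)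
  have h3 : y ≠ c := fun e => h.avoid_right.1 (e ▸ hc)
  have h4 : x ≠ d := fun e => h.avoid_left.2 (e ▸ hd)
  have h5 : y ≠ d := fun e => h.avoid_right.2 (e ▸ hd)
  have h6 := h.ne
  lia

theorem H0_not_isMinor_of_card [Fintype V] {G : SimpleGraph V} (h : Fintype.card V < 9) :
    ¬ H0.IsMinor G := by
  intro hm
  obtain ⟨B, hB⟩ := isMinor_iff_exists_isModel.1 hm
  have := hB.card_le
  simp at this
  lia

/-- `K₂,₃` as a double subdivision of `K₃`. -/
abbrev doubledTriangle (a b : Fin 3) : SimpleGraph (Fin 3 ⊕ Fin 2) :=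
  (⊤ : SimpleGraph (Fin 3)).doubleSubdivision a b

set_option synthInstance.maxHeartbeats 200000 in
set_option synthInstance.maxSize 2000 in
set_option maxRecDepth 10000 in
theorem doubleSubdivision_top_degree_two : ∀ a b : Fin 3, a ≠ b → ∀ s y z, y ≠ z →
    (∀ u, (doubledTriangle a b).Adj s u ↔ u = y ∨ u = z) → ¬ (doubledTriangle a b).Adj y z ∧
      ∃ d e, (d ≠ e ∧ ¬ (doubledTriangle a b).Adj d e) ∧ (∀ v, v = s ∨ v = y ∨ v = z ∨ v = d ∨ v = e) ∧
        (s ≠ d ∧ y ≠ d ∧ z ≠ d ∧ s ≠ e ∧ y ≠ e ∧ z ≠ e) ∧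
        (doubledTriangle a b).Adj y d ∧ (doubledTriangle a b).Adj z d ∧
        (doubledTriangle a b).Adj y e ∧ (doubledTriangle a b).Adj z e := by
  decide

set_option maxRecDepth 10000 in
theorem doubleSubdivision_top_triangle_free : ∀ a b : Fin 3, a ≠ b → ∀ x c d,
    (doubledTriangle a b).Adj x c → (doubledTriangle a b).Adj x d → ¬ (doubledTriangle a b).Adj c d := by
  decide

set_option synthInstance.maxHeartbeats 200000 in
set_option synthInstance.maxSize 2000 in
set_option maxRecDepth 10000 in
theorem doubleSubdivision_top_thin : ∀ a b : Fin 3, a ≠ b → ∀ u v, (doubledTriangle a b).Adj u v →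
    (∀ c d, (doubledTriangle a b).Adj u c → (doubledTriangle a b).Adj u d → c = d ∨ c = v ∨ d = v) ∨
      (∀ c d, (doubledTriangle a b).Adj v c → (doubledTriangle a b).Adj v d → c = d ∨ c = u ∨ d = u) := by
  decide

/-- In K₂,₃ every edge has an end of degree two, and five vertices are too few for H₀ or for a thick
cut. -/
theorem triangleInvariant_doubleSubdivision_top {a b : Fin 3} (hab : a ≠ b) :
    ((⊤ : SimpleGraph (Fin 3)).doubleSubdivision a b).TriangleInvariant := by
  have hrob := edgeRobust_top_fin_three.doubleSubdivision (a := a) (b := b) hab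
  refine ⟨hrob, ?_, ?_, iff_of_false ?_ (H0_not_isMinor_of_card (by simp))⟩
  · intro s y z hyz hN
    obtain ⟨h0, d, e, ⟨h1, h2⟩, h3, ⟨h4, h5, h6, h7, h8, h9⟩, h10, h11, h12, h13⟩ :=
      doubleSubdivision_top_degree_two a b hab s y z hyz hN
    refine ⟨h0, ![{d}, {e}], ?_, ?_, ?_, ?_, ?_, ?_⟩
    · exact Fin.forall_fin_two.2 ⟨isConn_singleton _ _, isConn_singleton _ _⟩
    · intro v e1 e2 e3
      rcases (((h3 v).resolve_left e1).resolve_left e2).resolve_left e3 with rfl | rfl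
      exacts [⟨0, rfl⟩, ⟨1, rfl⟩]
    · exact Fin.forall_fin_two.2 ⟨⟨h4, h5, h6⟩, ⟨h7, h8, h9⟩⟩
    · have hsep : ∀ u ∈ ({d} : Set (Fin 3 ⊕ Fin 2)), ∀ v ∈ ({e} : Set (Fin 3 ⊕ Fin 2)),
          ¬ (u = v ∨ (doubledTriangle a b).Adj u v) := by
        rintro _ rfl _ rfl hue
        exact hue.elim h1 h2
      refine Fin.forall_fin_two.2 ⟨Fin.forall_fin_two.2 ⟨fun _ _ _ _ _ => rfl, ?_⟩,
        Fin.forall_fin_two.2 ⟨?_, fun _ _ _ _ _ => rfl⟩⟩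
      · exact fun u hu v hv hue => (hsep u hu v hv hue).elim
      · exact fun u hu v hv hue => (hsep v hv u hu (hue.imp Eq.symm Adj.symm)).elim
    · exact Fin.forall_fin_two.2 ⟨⟨d, rfl, h10⟩, ⟨e, rfl, h12⟩⟩
    · exact Fin.forall_fin_two.2 ⟨⟨d, rfl, h11⟩, ⟨e, rfl, h13⟩⟩
  · rintro u v e ⟨c, d, hcd, h1, h2, h3, h4⟩ ⟨c', d', hcd', h1', h2', h3', h4'⟩
    rcases doubleSubdivision_top_thin a b hab u v e with h | h
    · rcases h c d h3 h4 with h | h | h <;> contradiction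
    · rcases h c' d' h3' h4' with h | h | h <;> contradiction
  · rintro ⟨x, y, C, D, h⟩
    obtain ⟨d, hd⟩ := h.nonempty
    obtain ⟨c, hc, c', hc', hcc, hxc, hxc'⟩ := h.left
    obtain ⟨v, hv, hcv⟩ := h.conn.exists_adj_of_mem hc hc' hcc.symm
    have hvc' : v ≠ c' := by
      rintro rfl
      exact doubleSubdivision_top_triangle_free a b hab x c v hxc hxc' hcv
    have hx : ∀ u ∈ C, x ≠ u := fun u hu e => h.avoid_left.1 (e ▸ hu)
    have hy : ∀ u ∈ C, y ≠ u := fun u hu e => h.avoid_right.1 (e ▸ hu)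
    have hdu : ∀ u ∈ C, d ≠ u := fun u hu e => (h.sep u hu d hd).1 e.symm
    have hxd : x ≠ d := fun e => h.avoid_left.2 (e ▸ hd)
    have hyd : y ≠ d := fun e => h.avoid_right.2 (e ▸ hd)
    -- As the graph is triangle-free, `c` has a neighbour `v` in `C` other than `c'`; a thick cut
    -- thus needs six vertices.
    have hcard : ({x, y, d, c, c', v} : Finset (Fin 3 ⊕ Fin 2)).card = 6 := by
      repeat rw [Finset.card_insert_of_notMem]
      · simp
      · simpa using hvc'.symm
      · simpa using ⟨hcc, hcv.ne⟩
      · simpa using ⟨hdu c hc, hdu c' hc', hdu v hv⟩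
      · simpa using ⟨hyd, hy c hc, hy c' hc', hy v hv⟩
      · simpa using ⟨h.ne, hxd, hx c hc, hx c' hc', hx v hv⟩
    have := hcard ▸ Finset.card_le_univ ({x, y, d, c, c', v} : Finset (Fin 3 ⊕ Fin 2))
    simp at this

/-- Up to isomorphism, a generalised triangle is `K₃` or satisfies the invariant. -/
theorem IsGeneralisedTriangle.exists_iso {V : Type u} {G : SimpleGraph V}
    (h : G.IsGeneralisedTriangle) : Nonempty (G ≃g (⊤ : SimpleGraph (Fin 3))) ∨
      ∃ (V' : Type) (G' : SimpleGraph V'), G'.TriangleInvariant ∧ Nonempty (G ≃g G') := by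
  induction h with
  | triangle e => exact Or.inl ⟨e⟩
  | doubleSubdivision hG hab e ih =>
    right
    rcases ih with ⟨⟨f⟩⟩ | ⟨V', G', hG', ⟨f⟩⟩
    · exact ⟨_, _, triangleInvariant_doubleSubdivision_top (f.map_adj_iff.2 hab),
        ⟨e.trans (doubleSubdivisionCongr f _ _)⟩⟩
    · exact ⟨_, _, hG'.doubleSubdivision (f.map_adj_iff.2 hab),
        ⟨e.trans (doubleSubdivisionCongr f _ _)⟩⟩

theorem H0_isMinor_congr {G : SimpleGraph V} {G' : SimpleGraph V'} (e : G ≃g G') :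
    H0.IsMinor G ↔ H0.IsMinor G' := by
  simp only [isMinor_iff_exists_isModel]
  exact ⟨fun ⟨_, hB⟩ => ⟨_, hB.map_iso e⟩, fun ⟨_, hB⟩ => ⟨_, hB.map_iso e.symm⟩⟩

theorem IsGeneralisedTriangle.edgeRobust_and {V : Type u} {G : SimpleGraph V}
    (h : G.IsGeneralisedTriangle) : G.EdgeRobust ∧ (G.HasThickCut ↔ H0.IsMinor G) := by
  rcases h.exists_iso with ⟨⟨e⟩⟩ | ⟨V', G', h, ⟨e⟩⟩
  · exact ⟨edgeRobust_top_fin_three.map_iso e.symm,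
      iff_of_false (fun h => not_hasThickCut_top_fin_three (h.map_iso e))
        fun h => H0_not_isMinor_of_card (by simp) ((H0_isMinor_congr e).1 h)⟩
  · exact ⟨h.robust.map_iso e.symm, ⟨fun hC => (H0_isMinor_congr e).2
      (h.thickCut_iff.1 (hC.map_iso e)),
      fun hm => (h.thickCut_iff.2 ((H0_isMinor_congr e).1 hm)).map_iso e.symm⟩⟩

/-! ### Property P₁ in terms of thick cuts -/

theorem twoCutBridge_neighborSet_left {G : SimpleGraph V} {x y : V} (hxy : ¬ G.Adj x y)
    (C : (G.induce ({x, y} : Set V)ᶜ).ConnectedComponent) :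
    (G.twoCutBridge x y C).neighborSet x = {v ∈ Subtype.val '' C.supp | G.Adj x v} := by
  ext v
  simp only [twoCutBridge, Subgraph.mem_neighborSet, Subgraph.induce_adj, Subgraph.top_adj,
    Set.mem_union, Set.mem_insert_iff, Set.mem_singleton_iff, Set.mem_ofPred_eq]
  constructor
  · rintro ⟨-, hv | rfl | rfl, e⟩
    · exact ⟨hv, e⟩
    · exact (G.loopless.irrefl _ e).elim
    · exact (hxy e).elim
  · exact fun ⟨hv, e⟩ => ⟨Or.inr (Or.inl trivial), Or.inl hv, e⟩

theorem twoCutBridge_neighborSet_right {G : SimpleGraph V} {x y : V} (hxy : ¬ G.Adj x y)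
    (C : (G.induce ({x, y} : Set V)ᶜ).ConnectedComponent) :
    (G.twoCutBridge x y C).neighborSet y = {v ∈ Subtype.val '' C.supp | G.Adj y v} := by
  ext v
  simp only [twoCutBridge, Subgraph.mem_neighborSet, Subgraph.induce_adj, Subgraph.top_adj,
    Set.mem_union, Set.mem_insert_iff, Set.mem_singleton_iff, Set.mem_ofPred_eq]
  constructor
  · rintro ⟨-, hv | rfl | rfl, e⟩
    · exact ⟨hv, e⟩
    · exact (hxy e.symm).elim
    · exact (G.loopless.irrefl _ e).elim
  · exact fun ⟨hv, e⟩ => ⟨Or.inr (Or.inr trivial), Or.inl hv, e⟩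

theorem EdgeRobust.isTwoCut_iff [Finite V] {G : SimpleGraph V} (h : G.EdgeRobust) {x y : V} :
    G.IsTwoCut x y ↔ x ≠ y ∧ ∃ u v : ({x, y}ᶜ : Set V),
      ¬ (G.induce ({x, y} : Set V)ᶜ).Reachable u v := by
  have hc : G.Connected := (induceUnivIso G).connected_iff.1 (connected_induce_iff_isConn.2 h.univ)
  have : Nat.card G.ConnectedComponent = 1 := by
    have := hc.nonempty
    have := hc.preconnected.subsingleton_connectedComponent
    exact Nat.card_unique
  rw [IsTwoCut, IsCutSet, this, Finite.one_lt_card_iff_nontrivial]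
  refine and_congr_right fun _ => ⟨?_, ?_⟩
  · rintro ⟨C, D, hCD⟩
    induction C using ConnectedComponent.ind with | _ u
    induction D using ConnectedComponent.ind with | _ v
    exact ⟨u, v, fun h => hCD (ConnectedComponent.eq.2 h)⟩
  · rintro ⟨u, v, huv⟩
    exact ⟨_, _, fun h => huv (ConnectedComponent.eq.1 h)⟩

theorem exists_pair_of_ncard_ne_one [Finite V] {S : Set V} {x : V} {G : SimpleGraph V}
    (h : {v ∈ S | G.Adj x v}.ncard ≠ 1) (hne : ∃ v ∈ S, G.Adj x v) :
    ∃ c ∈ S, ∃ d ∈ S, c ≠ d ∧ G.Adj x c ∧ G.Adj x d := by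
  obtain ⟨c, hc, hxc⟩ := hne
  by_contra! hcon
  refine h (Set.ncard_eq_one.2 ⟨c, Set.eq_singleton_iff_unique_mem.2 ⟨⟨hc, hxc⟩, ?_⟩⟩)
  rintro d ⟨hd, hxd⟩
  by_contra hdc
  exact hcon c hc d hd (Ne.symm hdc) hxc hxd

theorem ncard_ne_one_of_exists_pair {S : Set V} {x : V} {G : SimpleGraph V}
    (h : ∃ c ∈ S, ∃ d ∈ S, c ≠ d ∧ G.Adj x c ∧ G.Adj x d) : {v ∈ S | G.Adj x v}.ncard ≠ 1 := by
  obtain ⟨c, hc, d, hd, hcd, h1, h2⟩ := h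
  intro h
  obtain ⟨e, he⟩ := Set.ncard_eq_one.1 h
  have hce : c = e := he.le ⟨hc, h1⟩
  have hde : d = e := he.le ⟨hd, h2⟩
  exact hcd (hce.trans hde.symm)

/-- Robustness at edges makes the vertices of a 2-cut nonadjacent, so degrees in a bridge count
neighbours in its component. Robustness at vertices makes these degrees positive, so a degree other
than one means two neighbours. -/
theorem EdgeRobust.forall_propertyP1_iff [Finite V] {G : SimpleGraph V} (h : G.EdgeRobust) :
    (∀ x y, G.IsTwoCut x y → G.PropertyP1 x y) ↔ ¬ G.HasThickCut := by
  constructor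
  · rintro hP ⟨x, y, C, D, hC⟩
    obtain ⟨c, hc, -⟩ := hC.left
    obtain ⟨d, hd⟩ := hC.nonempty
    have hCxy : ∀ v ∈ C, v ∈ ({x, y}ᶜ : Set V) := by
      intro v hv
      have h1 := hC.avoid_left.1
      have h2 := hC.avoid_right.1
      simp
      grind
    have hDxy : ∀ v ∈ D, v ∈ ({x, y}ᶜ : Set V) := by
      intro v hv
      have h1 := hC.avoid_left.2
      have h2 := hC.avoid_right.2
      simp
      grind
    have hstay : ∀ (u v : ({x, y}ᶜ : Set V)) (_ : (G.induce ({x, y} : Set V)ᶜ).Walk u v),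
        u.1 ∈ C → v.1 ∈ C := by
      intro u v p
      induction p with
      | nil => exact id
      | @cons u w _ e _ ih =>
        refine fun hu => ih ?_
        have hw : ¬ (w.1 = x ∨ w.1 = y) := w.2
        push Not at hw
        exact (hC.cover w hw.1 hw.2).resolve_right fun hD => (hC.sep u hu w hD).2 e
    have hcut : G.IsTwoCut x y := by
      refine h.isTwoCut_iff.2 ⟨hC.ne, ⟨c, hCxy c hc⟩, ⟨d, hDxy d hd⟩, ?_⟩
      rintro ⟨p⟩
      exact (hC.sep d (hstay _ _ p hc) d hd).1 rfl
    have hxy : ¬ G.Adj x y := by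
      intro e
      have := (h.edge x y e).2 C hCxy ⟨c, hc⟩ (fun u hu v hv e => by
        have hw : ¬ (v = x ∨ v = y) := hv
        push Not at hw
        exact (hC.cover v hw.1 hw.2).resolve_right fun hD => (hC.sep u hu v hD).2 e)
      exact (hC.sep d (this (hDxy d hd)) d hd).1 rfl
    let K := (G.induce ({x, y} : Set V)ᶜ).connectedComponentMk ⟨c, hCxy c hc⟩
    have hK : Subtype.val '' K.supp = C := by
      ext v
      constructor
      · rintro ⟨w, hw, rfl⟩
        obtain ⟨p⟩ := ConnectedComponent.exact hw
        exact hstay _ _ p.reverse hc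
      · intro hv
        refine ⟨⟨v, hCxy v hv⟩, ConnectedComponent.sound ?_, rfl⟩
        have := (connected_induce_iff_isConn.2 hC.conn).preconnected ⟨v, hv⟩ ⟨c, hc⟩
        exact this.map (induceHomOfLE G hCxy).toHom
    have := hP x y hcut K
    rw [twoCutBridge_neighborSet_left hxy, twoCutBridge_neighborSet_right hxy, hK] at this
    exact this.elim (ncard_ne_one_of_exists_pair hC.left) (ncard_ne_one_of_exists_pair hC.right)
  · intro hT x y hcut K
    by_contra! hK
    obtain ⟨hne, u, v, huv⟩ := h.isTwoCut_iff.1 hcut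
    refine hT ⟨x, y, Subtype.val '' K.supp, Subtype.val '' K.suppᶜ, ?_⟩
    have hnr : ∃ w, w ∉ K.supp := by
      by_contra! hall
      exact huv (ConnectedComponent.exact ((hall u).trans (hall v).symm))
    obtain ⟨w, hw⟩ := hnr
    obtain ⟨k, hk⟩ := K.nonempty_supp
    have hsep : ∀ u ∈ Subtype.val '' K.supp, ∀ v ∈ Subtype.val '' K.suppᶜ, u ≠ v ∧ ¬ G.Adj u v := by
      rintro _ ⟨u, hu, rfl⟩ _ ⟨v, hv, rfl⟩
      refine ⟨fun e => hv (Subtype.ext e ▸ hu), fun e => hv ?_⟩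
      exact K.mem_supp_of_adj_mem_supp hu (by exact e)
    have hcov : ∀ v, v ≠ x → v ≠ y → v ∈ Subtype.val '' K.supp ∨ v ∈ Subtype.val '' K.suppᶜ := by
      intro v h1 h2
      have hv : v ∈ ({x, y}ᶜ : Set V) := by simp [h1, h2]
      by_cases hvK : ⟨v, hv⟩ ∈ K.supp
      · exact Or.inl ⟨_, hvK, rfl⟩
      · exact Or.inr ⟨_, hvK, rfl⟩
    have hconn : G.IsConn (Subtype.val '' K.supp) := by
      refine ⟨⟨k, k, hk, rfl⟩, ?_⟩
      rintro T hT ⟨_, ht⟩ hcl _ ⟨s, hs, rfl⟩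
      obtain ⟨t, htK, rfl⟩ := hT ht
      have hstay : ∀ (u v : ({x, y}ᶜ : Set V)) (_ : (G.induce ({x, y} : Set V)ᶜ).Walk u v),
          u.1 ∈ T → v.1 ∈ T := by
        intro u v p
        induction p with
        | nil => exact id
        | @cons u w _ e _ ih =>
          refine fun hu => ih (hcl u hu w ⟨w, ?_, rfl⟩ e)
          obtain ⟨u', hu', huu⟩ := hT hu
          exact K.mem_supp_of_adj_mem_supp (Subtype.ext huu ▸ hu') e
      obtain ⟨p⟩ := ConnectedComponent.exact (htK.trans hs.symm)
      exact hstay _ _ p ht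
    have hxK : ∀ (S : Set ({x, y}ᶜ : Set V)), x ∉ Subtype.val '' S ∧ y ∉ Subtype.val '' S := by
      intro S
      constructor <;> rintro ⟨s, -, hs⟩ <;> have := s.2 <;> simp [hs] at this
    have hxy : ¬ G.Adj x y := by
      intro e
      exact huv ((connected_induce_iff_isConn.2 (h.edge x y e)).preconnected u v)
    rw [twoCutBridge_neighborSet_left hxy, twoCutBridge_neighborSet_right hxy] at hK
    -- If `x'` had no neighbour in the component, deleting `y'` alone would separate the component
    -- from `x'`.
    have hatt : ∀ x' y', x' ≠ y' → (∀ v, v ≠ x' → v ≠ y' → v ≠ x ∧ v ≠ y) →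
        x' ∉ Subtype.val '' K.supp → y' ∉ Subtype.val '' K.supp →
        ∃ v ∈ Subtype.val '' K.supp, G.Adj x' v := by
      intro x' y' hne' hxy' hx' hy'
      by_contra! hcon
      refine hx' ((h.vertex y').2 _ (fun v hv hvy => hy' (hvy ▸ hv)) ⟨k, k, hk, rfl⟩
        (fun u hu v hv e => ?_) hne')
      have hvx : v ≠ x' := by rintro rfl; exact hcon u hu e.symm
      obtain ⟨h1, h2⟩ := hxy' v hvx hv
      exact (hcov v h1 h2).resolve_right fun hv' => (hsep u hu v hv').2 e
    exact ⟨hne, hconn, ⟨w, w, hw, rfl⟩, hcov, ⟨(hxK _).1, (hxK _).1⟩, ⟨(hxK _).2, (hxK _).2⟩,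
      hsep, exists_pair_of_ncard_ne_one hK.1
        (hatt x y hne (fun _ h1 h2 => ⟨h1, h2⟩) (hxK _).1 (hxK _).2),
      exists_pair_of_ncard_ne_one hK.2
        (hatt y x hne.symm (fun _ h1 h2 => ⟨h2, h1⟩) (hxK _).2 (hxK _).1)⟩

end SimpleGraph

theorem lemma16 {V : Type*} [Finite V] (G : SimpleGraph V) (hG : G.IsGeneralisedTriangle) :
    G.MemK1 ↔ ¬ SimpleGraph.H0.IsMinor G := by
  obtain ⟨hrob, hiff⟩ := hG.edgeRobust_and
  rw [← hiff, ← hrob.forall_propertyP1_iff]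
  exact and_iff_right hG
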